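/- Let $F:\mathbb R^k\to\mathbb R^k$ be smooth with $F(0)=0$, and consider the difference equation $U(n+1)=F(U(n))$, $n\in\mathbb Z$. Assume: (i) a finite group $G$ acts on $\mathbb R^k$ by orthogonal maps $T(\theta)$, $\theta\in G$, with $F(T(\theta)U)=T(\theta)F(U)$ for all $\theta\in G$, $U\in\mathbb R^k$; (ii) $0$ is hyperbolic: there is $r>1$ such that every complex eigenvalue $\nu$ of $DF(0)$ satisfies $|\nu|\le 1/r$ or $|\nu|\ge r$, where eigenvalues with $|\nu|=1/r$ or $|\nu|=r$ (if any) are semisimple; and the stable and unstable eigenspaces $E^s,E^u$ of $DF(0)$ have dimension at least $1$; (iii) $Q:\mathbb Z\to\mathbb R^k$ is a homoclinic orbit: $Q(n+1)=F(Q(n))$ for all $n$, and $Q(n)\to0$ as $n\to\pm\infty$; (iv) the stable and unstable manifolds $W^s(0)$, $W^u(0)$ intersect transversely along $Q$: $T_{Q(n)}W^s(0)+T_{Q(n)}W^u(0)=\mathbb R^k$ for all $n\in\mathbb Z$. (Here the tangent spaces are those of the immersed manifolds: $T_{p}W^s(0)$ is spanned by the velocities at $p$ of curves $\gamma$ through $p$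 with $F^n(\gamma(t))\to0$ as $n\to\infty$ uniformly in $t$, and $T_{Q(n)}W^u(0)$ by the velocities at $Q(n)$ of curves $t\mapsto\Gamma_t(0)$, where $\Gamma_t(j)$, $j\ge0$, are backward orbits, $F(\Gamma_t(j+1))=\Gamma_t(j)$, differentiable in $t$ at $t=0$ for each $j$, with $\Gamma_0(j)=Q(n-j)$ and $\Gamma_t(j)\to0$ as $j\to\infty$ uniformly in $t$. No invertibility of $F$ is assumed.) Then there are an integer $N_0\ge1$ and constants $\delta,C>0$ with the following property. Let $m>1$, let $N_1,\dots,N_{m-1}\ge N_0$ be integers and let $\theta_1,\dots,\theta_m\in G$. Put $N_i^+=\lfloor N_i/2\rfloor$, $N_i^-=N_i-N_i^+$, $N_0^-=N_m^+=\infty$, $N=\frac12\min_i N_i$ and $c_i=N_1+\dots+N_{i-1}$ (so $c_1=0$). For $U:\mathbb Z\to\mathbb R^k$ define remainder terms $\tilde Q_i^\pm$, $1\le i\le m$, by $$U(c_i+n)=T(\theta_i)Q(n)+\tilde Q_i^-(n)\quad (n\in[-N_{i-1}^-,0]),\qquad U(c_i+n)=T(\theta_i)Q(n)+\tilde Q_i^+(n)\quad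 (n\in[0,N_i^+]).$$ Then there is exactly one solution $U$ of $U(n+1)=F(U(n))$, $n\in\mathbb Z$, all of whose remainder terms satisfy $\|\tilde Q_i^\pm\|_\infty\le\delta$. This solution (the $m$-pulse solution) satisfies $U(n)\to0$ as $n\to\pm\infty$, and $$\|\tilde Q_i^\pm\|_\infty\le C r^{-N}\qquad(1\le i\le m),$$ $$|\tilde Q_i^+(N_i^+)-T(\theta_{i+1})Q(-N_i^-)|\le C r^{-2N},\qquad |\tilde Q_{i+1}^-(-N_i^-)-T(\theta_i)Q(N_i^+)|\le C r^{-2N}\qquad(1\le i\le m-1).$$ -/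

import Mathlib

open Filter Topology

namespace MultiPulse

/-- The complexification, acting on `ℂ^k`, of a real linear map of `ℝ^k`. -/
noncomputable def complexification {k : ℕ}
    (A : EuclideanSpace ℝ (Fin k) →L[ℝ] EuclideanSpace ℝ (Fin k)) :
    Module.End ℂ (Fin k → ℂ) :=
  Matrix.toLin' (Matrix.of fun i j => ((A (EuclideanSpace.single j (1 : ℝ)) i : ℝ) : ℂ))

/-- The (complexified) stable eigenspace of `A`: the sum of the generalized eigenspaces of the
eigenvalues inside the unit circle. Its complex dimension is the real dimension of `E^s`. -/
noncomputable def stableEigenspace {k : ℕ}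
    (A : EuclideanSpace ℝ (Fin k) →L[ℝ] EuclideanSpace ℝ (Fin k)) :
    Submodule ℂ (Fin k → ℂ) :=
  ⨆ ν : {ν : ℂ // ‖ν‖ < 1}, (complexification A).maxGenEigenspace ν.1

/-- The (complexified) unstable eigenspace of `A`: the sum of the generalized eigenspaces of the
eigenvalues outside the unit circle. -/
noncomputable def unstableEigenspace {k : ℕ}
    (A : EuclideanSpace ℝ (Fin k) →L[ℝ] EuclideanSpace ℝ (Fin k)) :
    Submodule ℂ (Fin k → ℂ) :=
  ⨆ ν : {ν : ℂ // 1 < ‖ν‖}, (complexification A).maxGenEigenspace ν.1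

/-- `A` is hyperbolic with rate `r > 1`: every complex eigenvalue `ν` has `|ν| ≤ 1/r` or
`|ν| ≥ r`, the eigenvalues on the two extremal circles (if there are any) being semisimple, and
the stable and the unstable eigenspace are nontrivial. -/
structure IsHyperbolic {k : ℕ}
    (A : EuclideanSpace ℝ (Fin k) →L[ℝ] EuclideanSpace ℝ (Fin k)) (r : ℝ) : Prop where
  one_lt : 1 < r
  gap : ∀ ν : ℂ, (complexification A).HasEigenvalue ν → ‖ν‖ ≤ 1 / r ∨ r ≤ ‖ν‖
  semisimple : ∀ ν : ℂ, ‖ν‖ = 1 / r ∨ ‖ν‖ = r →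
    (complexification A).maxGenEigenspace ν = (complexification A).eigenspace ν
  one_le_dim_stable : 1 ≤ Module.finrank ℂ (stableEigenspace A)
  one_le_dim_unstable : 1 ≤ Module.finrank ℂ (unstableEigenspace A)

section Dynamics

variable {E : Type*} [NormedAddCommGroup E] [NormedSpace ℝ E]

/-- `U` is a solution, on all of `ℤ`, of the difference equation `U(n+1) = F(U(n))`. -/
def IsOrbit (F : E → E) (U : ℤ → E) : Prop :=
  ∀ n : ℤ, U (n + 1) = F (U n)

/-- `U` is an orbit which connects the equilibrium `0` to itself. -/
def IsHomoclinicOrbit (F : E → E) (U : ℤ → E) : Prop :=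
  IsOrbit F U ∧ Tendsto U atTop (𝓝 0) ∧ Tendsto U atBot (𝓝 0)

/-- The stable manifold `W^s(0)` of the fixed point `0`, as a set. -/
def stableManifold (F : E → E) : Set E :=
  {x | Tendsto (fun n : ℕ => F^[n] x) atTop (𝓝 0)}

/-- `y` is a backward orbit (`y j` is a `j`-th preimage of `y 0`) converging to `0`. -/
def IsBackwardOrbit (F : E → E) (y : ℕ → E) : Prop :=
  (∀ j : ℕ, F (y (j + 1)) = y j) ∧ Tendsto y atTop (𝓝 0)

/-- The unstable manifold `W^u(0)` of the fixed point `0`, as a set. -/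
def unstableManifold (F : E → E) : Set E :=
  {x | ∃ y : ℕ → E, y 0 = x ∧ IsBackwardOrbit F y}

/-- The tangent space of `W^s(0)` at `p`: the velocities at `p` of the curves in `W^s(0)` through
`p`. Since `W^s(0)` is in general only an immersed submanifold (it may accumulate on itself), the
curves have to be continuous for its intrinsic topology, that is, a common iterate of `F` takes the
curve, near `p`, into any given local stable manifold: the convergence `F^n (γ t) → 0` is
uniform in `t`. -/
def stableTangentSpace (F : E → E) (p : E) : Submodule ℝ E :=
  Submodule.span ℝ {v | ∃ (γ : ℝ → E) (τ : ℝ), 0 < τ ∧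
    γ 0 = p ∧ HasDerivAt γ v 0 ∧
    (∀ t ∈ Set.Ioo (-τ) τ, γ t ∈ stableManifold F) ∧
    TendstoUniformlyOn (fun (n : ℕ) (t : ℝ) => F^[n] (γ t)) (fun _ => 0) atTop (Set.Ioo (-τ) τ)}

/-- The tangent space of `W^u(0)` at the point `p = y 0` with backward orbit `y` (which is
determined by `p` if `F` is injective): the velocities at `p` of the curves in `W^u(0)` through
`p`. As for `W^s(0)`, the curves, here `t ↦ Γ t 0`, are those for the structure of immersed
submanifold of `W^u(0)`: they are carried along by differentiable curves `t ↦ Γ t j` of `j`-th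
preimages which converge to `0` uniformly in `t`. If `F` is a diffeomorphism, then
`Γ t j = F^{-j} (Γ t 0)`, and this is the tangent space of the stable manifold of `F^{-1}`. -/
def unstableTangentSpace (F : E → E) (y : ℕ → E) : Submodule ℝ E :=
  Submodule.span ℝ {v | ∃ (Γ : ℝ → ℕ → E) (τ : ℝ), 0 < τ ∧
    Γ 0 = y ∧ HasDerivAt (fun t => Γ t 0) v 0 ∧
    (∀ j : ℕ, DifferentiableAt ℝ (fun t => Γ t j) 0) ∧
    (∀ t ∈ Set.Ioo (-τ) τ, IsBackwardOrbit F (Γ t)) ∧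
    TendstoUniformlyOn (fun (j : ℕ) (t : ℝ) => Γ t j) (fun _ => 0) atTop (Set.Ioo (-τ) τ)}

/-- `W^s(0)` and `W^u(0)` intersect transversely along the homoclinic orbit `Q`: at every `Q(n)`
the two tangent spaces together span the whole space. -/
def IntersectTransverselyAlong (F : E → E) (Q : ℤ → E) : Prop :=
  ∀ n : ℤ, stableTangentSpace F (Q n) ⊔ unstableTangentSpace F (fun j : ℕ => Q (n - j)) = ⊤

end Dynamics

/-! In the following the pulses carry the indices `1, …, m`; `N i` is the distance between the
pulses `i` and `i + 1`, for `1 ≤ i ≤ m - 1`. Other values of `N` play no role. -/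

/-- `N_i^+ = ⌊N_i / 2⌋`. -/
def distPlus (N : ℕ → ℕ) (i : ℕ) : ℤ := ((N i / 2 : ℕ) : ℤ)

/-- `N_i^- = N_i - N_i^+`. -/
def distMinus (N : ℕ → ℕ) (i : ℕ) : ℤ := (N i : ℤ) - distPlus N i

/-- The number `½ min {N_1, …, N_{m-1}}`. -/
noncomputable def halfMinDist (m : ℕ) (N : ℕ → ℕ) : ℝ :=
  ((sInf (N '' Set.Icc 1 (m - 1)) : ℕ) : ℝ) / 2

/-- The position `N_1 + … + N_{i-1}` of the centre of the `i`-th pulse; the first one is at `0`. -/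
def center (N : ℕ → ℕ) (i : ℕ) : ℤ := ∑ j ∈ Finset.Ico 1 i, (N j : ℤ)

/-- The domain `[-N_{i-1}^-, 0]` of the left half of the `i`-th pulse, where `N_0^- = ∞`. -/
def leftDomain (N : ℕ → ℕ) (i : ℕ) : Set ℤ :=
  {n | n ≤ 0 ∧ (i ≠ 1 → -distMinus N (i - 1) ≤ n)}

/-- The domain `[0, N_i^+]` of the right half of the `i`-th pulse, where `N_m^+ = ∞`. -/
def rightDomain (m : ℕ) (N : ℕ → ℕ) (i : ℕ) : Set ℤ :=
  {n | 0 ≤ n ∧ (i ≠ m → n ≤ distPlus N i)}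

section Pulses

variable {k : ℕ} {G : Type*} [Group G]

/-- The remainder of a sequence `U` around its `i`-th pulse. The pieces `U_i^-` and `U_i^+` of `U`
are both given by `n ↦ U (center N i + n)`, on `leftDomain N i` and `rightDomain m N i`
respectively, and the remainder terms are defined by `U_i^± (n) = T(θ_i) Q(n) + remainder`. -/
noncomputable def remainder
    (T : G →* (EuclideanSpace ℝ (Fin k) ≃ₗᵢ[ℝ] EuclideanSpace ℝ (Fin k)))
    (Q : ℤ → EuclideanSpace ℝ (Fin k)) (N : ℕ → ℕ) (θ : ℕ → G)
    (U : ℤ → EuclideanSpace ℝ (Fin k)) (i : ℕ) (n : ℤ) : EuclideanSpace ℝ (Fin k) :=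
  U (center N i + n) - T (θ i) (Q n)

/-- All `2m` remainder terms of `U` have supremum norm at most `δ`. -/
def RemaindersLE
    (T : G →* (EuclideanSpace ℝ (Fin k) ≃ₗᵢ[ℝ] EuclideanSpace ℝ (Fin k)))
    (Q : ℤ → EuclideanSpace ℝ (Fin k)) (m : ℕ) (N : ℕ → ℕ) (θ : ℕ → G)
    (U : ℤ → EuclideanSpace ℝ (Fin k)) (δ : ℝ) : Prop :=
  ∀ i : ℕ, 1 ≤ i → i ≤ m → ∀ n ∈ leftDomain N i ∪ rightDomain m N i,
    ‖remainder T Q N θ U i n‖ ≤ δ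

end Pulses

end MultiPulse

/-! Let W be the sum of the m shifted and rotated copies of Q. The m-pulse is the orbit near W. It
comes from a contraction argument on bounded sequences, which needs two things: W is almost an
orbit, and V ↦ (V(n+1) - DF(W(n))V(n)) is invertible with a bound independent of m, the N_i and the
θ_i.

Decay. Semisimplicity on the extremal circles gives A = DF(0) a Green function bounded by a multiple
of r^(-|n|), with no polynomial factor. Since F - A is quadratic at 0, a preliminary rate ρ > √r for
Q makes F(Q) - AQ decay like ρ^(-2|n|), faster than r^(-|n|), so Q decays at the rate r itself
(`IsGreenFunction.exists_decay_of_sq_le`).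

Invertibility along Q. Tangent vectors of W^s and W^u propagate to bounded forward and backward
solutions of the variational equation. Transversality therefore solves the equation for right-hand
sides supported at one time, and this gives surjectivity. As DF(Q(n)) → A at both ends, the operator
differs in finitely many coefficients from an invertible one, so surjectivity forces injectivity
(`exists_hasAPrioriBound_of_transverse`). F is never inverted.

Invertibility along W. In a long window around any time, DF(W(n)) is close to the linearization
along one copy of Q. A cut-off argument glues the local bounds at the cost of a factor 2
(`hasAPrioriBound_of_windows`), and the same finite-modification principle gives surjectivity.

Error. By equivariance each copy is an exact orbit, so the residual of W consists of interactions
only. Products of different pulses are O(r^(-2N)) at every time, and sums over pulses are geometric,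
hence uniform in m (`norm_pulseSum_step_le`). Thus U - W = O(r^(-2N)). The remainder of W around a
pulse is mainly its neighbour, O(r^(-N)); at a gluing point, removing both neighbouring pulses
leaves pulses a full distance away, O(r^(-2N)). -/

namespace MultiPulse

open BoundedContinuousFunction

/-! ### The difference operator on bounded sequences and its Fredholm alternative. -/

section SequenceOperator

variable {E : Type*} [NormedAddCommGroup E] [NormedSpace ℝ E]

/-- A bounded two-sided sequence as an element of the Banach space of bounded sequences. -/
noncomputable def bddSeq {E : Type*} [NormedAddCommGroup E] (f : ℤ → E)
    (hf : ∃ C, ∀ n, ‖f n‖ ≤ C) : ℤ →ᵇ E :=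
  ofNormedAddCommGroupDiscrete f hf.choose hf.choose_spec

@[simp] theorem bddSeq_apply {E : Type*} [NormedAddCommGroup E] (f : ℤ → E)
    (hf : ∃ C, ∀ n, ‖f n‖ ≤ C) (n : ℤ) : bddSeq f hf n = f n := rfl

/-- The operator `V ↦ (V(n+1) - B(n) V(n))` on bounded sequences. -/
noncomputable def seqOp (B : ℤ →ᵇ (E →L[ℝ] E)) : (ℤ →ᵇ E) →L[ℝ] (ℤ →ᵇ E) :=
  LinearMap.mkContinuous
    { toFun := fun V => bddSeq (fun n => V (n + 1) - B n (V n)) ⟨‖V‖ + ‖B‖ * ‖V‖, fun n =>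
        (norm_sub_le _ _).trans (add_le_add (V.norm_coe_le_norm _)
          (((B n).le_opNorm _).trans (mul_le_mul (B.norm_coe_le_norm _) (V.norm_coe_le_norm _)
            (norm_nonneg _) (norm_nonneg B))))⟩
      map_add' := fun V W => by ext1 n; simp; abel
      map_smul' := fun c V => by ext1 n; simp [smul_sub] }
    (1 + ‖B‖) (fun V => (BoundedContinuousFunction.norm_le (by positivity)).2 fun n => by
      refine (norm_sub_le _ _).trans ?_
      rw [add_mul, one_mul]
      exact add_le_add (V.norm_coe_le_norm _)
          (((B n).le_opNorm _).trans (mul_le_mul (B.norm_coe_le_norm _) (V.norm_coe_le_norm _)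
            (norm_nonneg _) (norm_nonneg B))))

@[simp] theorem seqOp_apply (B : ℤ →ᵇ (E →L[ℝ] E)) (V : ℤ →ᵇ E) (n : ℤ) :
    seqOp B V n = V (n + 1) - B n (V n) := rfl

theorem norm_seqOp_sub_le (B B' : ℤ →ᵇ (E →L[ℝ] E)) : ‖seqOp B' - seqOp B‖ ≤ ‖B' - B‖ := by
  refine ContinuousLinearMap.opNorm_le_bound _ (norm_nonneg (B' - B)) fun V => ?_
  refine (BoundedContinuousFunction.norm_le (by positivity)).2 fun n => ?_
  have : (seqOp B' - seqOp B) V n = - (B' - B) n (V n) := by simp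
  rw [this, norm_neg]
  exact ((_ : E →L[ℝ] E).le_opNorm _).trans (mul_le_mul ((B' - B).norm_coe_le_norm n)
    (V.norm_coe_le_norm _) (norm_nonneg _) (norm_nonneg (B' - B)))

theorem continuous_seqOp : Continuous (seqOp (E := E)) := by
  refine LipschitzWith.continuous (K := 1) (LipschitzWith.of_dist_le_mul fun B B' => ?_)
  rw [dist_eq_norm (seqOp B) (seqOp B'), dist_eq_norm B B', NNReal.coe_one, one_mul]
  exact norm_seqOp_sub_le _ _

/-- Bijectivity of the sequence operator persists under small perturbations. -/
theorem exists_bijective_of_norm_sub_le [CompleteSpace E] (B : ℤ →ᵇ (E →L[ℝ] E))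
    (hB : Function.Bijective (seqOp B)) :
    ∃ ε > 0, ∀ B' : ℤ →ᵇ (E →L[ℝ] E), ‖B' - B‖ ≤ ε → Function.Bijective (seqOp B') := by
  let e := ContinuousLinearEquiv.ofBijective (seqOp B) (LinearMap.ker_eq_bot.2 hB.1)
    (LinearMap.range_eq_top.2 hB.2)
  have he : (e : (ℤ →ᵇ E) →L[ℝ] (ℤ →ᵇ E)) = seqOp B :=
    ContinuousLinearEquiv.coe_ofBijective _ _ _
  have h := e.nhds
  rw [he] at h
  obtain ⟨ε, hε, h⟩ := Metric.mem_nhds_iff.1 (continuous_seqOp.continuousAt.preimage_mem_nhds h)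
  refine ⟨ε / 2, half_pos hε, fun B' hB' => ?_⟩
  obtain ⟨e', he'⟩ := h (Metric.mem_ball.2 (by rw [dist_eq_norm B' B]; linarith) : B' ∈ _)
  rw [← he']
  exact e'.bijective

theorem exists_bound_of_bijective [CompleteSpace E] (B : ℤ →ᵇ (E →L[ℝ] E))
    (hB : Function.Bijective (seqOp B)) : ∃ K > 0, ∀ V, ‖V‖ ≤ K * ‖seqOp B V‖ := by
  let e := ContinuousLinearEquiv.ofBijective (seqOp B) (LinearMap.ker_eq_bot.2 hB.1)
    (LinearMap.range_eq_top.2 hB.2)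
  refine ⟨‖(e.symm : (ℤ →ᵇ E) →L[ℝ] (ℤ →ᵇ E))‖ + 1, by positivity, fun V => ?_⟩
  have h := (e.symm : (ℤ →ᵇ E) →L[ℝ] (ℤ →ᵇ E)).le_opNorm (seqOp B V)
  have h2 : (e.symm : (ℤ →ᵇ E) →L[ℝ] (ℤ →ᵇ E)) (seqOp B V) = V := e.symm_apply_apply V
  rw [h2] at h
  nlinarith [norm_nonneg (seqOp B V)]

/-- A finite rank perturbation of the identity is injective if and only if it is surjective. -/
theorem injective_iff_surjective_of_sub_mem {X : Type*} [AddCommGroup X] [Module ℝ X]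
    (T : X →ₗ[ℝ] X) (F : Submodule ℝ X) [FiniteDimensional ℝ F] (h : ∀ x, T x - x ∈ F) :
    Function.Injective T ↔ Function.Surjective T := by
  have hF : ∀ x ∈ F, T x ∈ F := fun x hx => by
    have := F.add_mem (h x) hx
    rwa [sub_add_cancel] at this
  have key := LinearMap.injective_iff_surjective (f := T.restrict hF)
  constructor
  · intro hT y
    have hi : Function.Injective (T.restrict hF) := fun a b hab =>
      Subtype.ext (hT (congrArg Subtype.val hab))
    obtain ⟨f, hf⟩ := key.1 hi ⟨T y - y, h y⟩
    have hf' : T f = T y - y := congrArg Subtype.val hf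
    exact ⟨y - f, by rw [map_sub, hf']; abel⟩
  · intro hT
    have hs : Function.Surjective (T.restrict hF) := fun y => by
      obtain ⟨x, hx⟩ := hT y
      have hxF : x ∈ F := by
        have := F.sub_mem y.2 (h x)
        rwa [hx, sub_sub_cancel] at this
      exact ⟨⟨x, hxF⟩, Subtype.ext hx⟩
    have hi := key.2 hs
    rw [← LinearMap.ker_eq_bot, LinearMap.ker_eq_bot']
    intro x hx
    have hxF : x ∈ F := by
      have := F.neg_mem (h x)
      rwa [hx, zero_sub, neg_neg] at this
    have : (⟨x, hxF⟩ : F) = 0 := hi (Subtype.ext (by simp [hx]))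
    exact congrArg Subtype.val this

/-- The sequence which vanishes except at one place. -/
noncomputable def deltaSeq (j : ℤ) : E →ₗ[ℝ] (ℤ →ᵇ E) where
  toFun e := bddSeq (fun n => if n = j then e else 0)
    ⟨‖e‖, fun n => by split_ifs <;> simp⟩
  map_add' a b := by ext1 n; by_cases h : n = j <;> simp [h]
  map_smul' c a := by ext1 n; by_cases h : n = j <;> simp [h]

@[simp] theorem deltaSeq_apply (j : ℤ) (e : E) (n : ℤ) :
    deltaSeq j e n = if n = j then e else 0 := rfl

/-- A sequence supported in a finite set is a sum of `deltaSeq`s. -/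
theorem eq_sum_deltaSeq (V : ℤ →ᵇ E) (s : Finset ℤ) (h : ∀ n ∉ s, V n = 0) :
    V = ∑ j ∈ s, deltaSeq j (V j) := by
  ext1 n
  rw [BoundedContinuousFunction.sum_apply]
  simp only [deltaSeq_apply]
  rw [Finset.sum_ite_eq]
  split_ifs with hn
  · rfl
  · exact h n hn

/-- The difference of the two operators takes values in sequences supported in `s`, a
finite-dimensional space. Composing `seqOp B'` with the inverse of `seqOp B` thus gives the identity
plus a map of finite rank. -/
theorem injective_iff_surjective_of_finite_support [FiniteDimensional ℝ E] [CompleteSpace E]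
    (B B' : ℤ →ᵇ (E →L[ℝ] E)) (hB : Function.Bijective (seqOp B)) (s : Finset ℤ)
    (h : ∀ n ∉ s, B' n = B n) :
    Function.Injective (seqOp B') ↔ Function.Surjective (seqOp B') := by
  let e := LinearEquiv.ofBijective (seqOp B : (ℤ →ᵇ E) →ₗ[ℝ] (ℤ →ᵇ E)) hB
  let F₀ : Submodule ℝ (ℤ →ᵇ E) := ⨆ j : s, LinearMap.range (deltaSeq (E := E) (j : ℤ))
  let F : Submodule ℝ (ℤ →ᵇ E) := F₀.map (e.symm : (ℤ →ᵇ E) →ₗ[ℝ] (ℤ →ᵇ E))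
  let T : (ℤ →ᵇ E) →ₗ[ℝ] (ℤ →ᵇ E) :=
    (e.symm : (ℤ →ᵇ E) →ₗ[ℝ] (ℤ →ᵇ E)) ∘ₗ (seqOp B' : (ℤ →ᵇ E) →ₗ[ℝ] (ℤ →ᵇ E))
  have hT : ∀ V, T V - V ∈ F := fun V => by
    refine ⟨seqOp B' V - seqOp B V, ?_, ?_⟩
    · rw [eq_sum_deltaSeq (seqOp B' V - seqOp B V) s fun n hn => by simp [h n hn]]
      exact Submodule.sum_mem _ fun j hj =>
        Submodule.mem_iSup_of_mem (⟨j, hj⟩ : s) ⟨_, rfl⟩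
    · have h1 : e.symm (seqOp B V) = V := e.symm_apply_apply V
      have h2 : T V = e.symm (seqOp B' V) := rfl
      rw [h2, LinearEquiv.coe_coe, map_sub, h1]
  have key := injective_iff_surjective_of_sub_mem T F hT
  have hinj : Function.Injective T ↔ Function.Injective (seqOp B') :=
    e.symm.injective.of_comp_iff (seqOp B')
  have hsurj : Function.Surjective T ↔ Function.Surjective (seqOp B') :=
    Function.Surjective.of_comp_iff' e.symm.bijective (seqOp B')
  rw [← hinj, ← hsurj, key]

/-- If the coefficients converge at both ends to an operator for which the sequence operator is
bijective, then it becomes bijective after a change of finitely many coefficients. -/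
theorem exists_bijective_finite_modification [CompleteSpace E]
    (A : E →L[ℝ] E) (hA : Function.Bijective (seqOp (BoundedContinuousFunction.const ℤ A)))
    (B : ℤ →ᵇ (E →L[ℝ] E)) (hB : Tendsto B cofinite (𝓝 A)) :
    ∃ (B' : ℤ →ᵇ (E →L[ℝ] E)) (s : Finset ℤ), Function.Bijective (seqOp B') ∧
      ∀ n ∉ s, B n = B' n := by
  obtain ⟨ε, hε, h⟩ := exists_bijective_of_norm_sub_le _ hA
  have hs : {n | ¬ ‖B n - A‖ < ε}.Finite := by
    have := Filter.eventually_cofinite.1 (hB.eventually (Metric.ball_mem_nhds A hε))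
    simpa only [Metric.mem_ball, dist_eq_norm] using this
  classical
  have hbd : ∀ n, ‖(if ‖B n - A‖ < ε then B n else A)‖ ≤ ‖B‖ + ‖A‖ := fun n => by
    split_ifs
    · linarith [B.norm_coe_le_norm n, norm_nonneg A]
    · linarith [norm_nonneg B]
  refine ⟨bddSeq (fun n => if ‖B n - A‖ < ε then B n else A) ⟨_, hbd⟩, hs.toFinset,
    h _ ((BoundedContinuousFunction.norm_le hε.le).2 fun n => ?_), fun n hn => ?_⟩
  · change ‖(if ‖B n - A‖ < ε then B n else A) - A‖ ≤ ε
    split_ifs with hn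
    · exact hn.le
    · simpa using hε.le
  · have hn' : ‖B n - A‖ < ε := by simpa using hn
    simp [hn']

/-- The Fredholm alternative for coefficients which converge at both ends. -/
theorem injective_iff_surjective_of_tendsto [FiniteDimensional ℝ E] [CompleteSpace E]
    (A : E →L[ℝ] E) (hA : Function.Bijective (seqOp (BoundedContinuousFunction.const ℤ A)))
    (B : ℤ →ᵇ (E →L[ℝ] E)) (hB : Tendsto B cofinite (𝓝 A)) :
    Function.Injective (seqOp B) ↔ Function.Surjective (seqOp B) := by
  obtain ⟨B', s, hB', hs⟩ := exists_bijective_finite_modification A hA B hB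
  exact injective_iff_surjective_of_finite_support B' B hB' s hs

end SequenceOperator

/-! ### Spectral gap, Green functions and absence of bounded orbits over ℂ. -/

section Green

variable {X : Type*} [NormedAddCommGroup X] [NormedSpace ℂ X]

/-- Induction on the height `k` of the generalized eigenvector, from `M^(n+1) x = M^n (M - ν) x + ν
M^n x`. The new constant `D` satisfies `C ≤ D (q - ‖ν‖)`, so that the bound `D q^n` reproduces
itself. -/
theorem exists_norm_pow_apply_le (M : Module.End ℂ X) {ν : ℂ} {q : ℝ} (hν : ‖ν‖ < q) (k : ℕ) :
    ∀ x, ((M - ν • (1 : Module.End ℂ X)) ^ k) x = 0 →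
      ∃ C, ∀ n : ℕ, ‖(M ^ n) x‖ ≤ C * q ^ n := by
  have hq : 0 < q := (norm_nonneg ν).trans_lt hν
  induction k with
  | zero =>
    intro x hx
    have hx : x = 0 := by simpa using hx
    exact ⟨0, fun n => by simp [hx]⟩
  | succ k ih =>
    intro x hx
    rw [pow_succ, Module.End.mul_apply] at hx
    obtain ⟨C, hC⟩ := ih _ hx
    have hd : 0 < q - ‖ν‖ := sub_pos.2 hν
    refine ⟨max ‖x‖ (C / (q - ‖ν‖)), fun n => ?_⟩
    induction n with
    | zero => simp
    | succ n ihn =>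
      have h1 : (M ^ (n + 1)) x
          = (M ^ n) ((M - ν • (1 : Module.End ℂ X)) x) + ν • (M ^ n) x := by
        rw [pow_succ, Module.End.mul_apply, ← map_smul, ← map_add]
        simp
      have h2 : C ≤ max ‖x‖ (C / (q - ‖ν‖)) * (q - ‖ν‖) :=
        (div_le_iff₀ hd).1 (le_max_right _ _)
      calc ‖(M ^ (n + 1)) x‖ ≤ C * q ^ n + ‖ν‖ * ‖(M ^ n) x‖ := by
            rw [h1]
            exact (norm_add_le _ _).trans (add_le_add (hC n) (norm_smul_le _ _))
        _ ≤ (max ‖x‖ (C / (q - ‖ν‖)) * (q - ‖ν‖)) * q ^ n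
            + ‖ν‖ * (max ‖x‖ (C / (q - ‖ν‖)) * q ^ n) := by gcongr
        _ = max ‖x‖ (C / (q - ‖ν‖)) * q ^ (n + 1) := by ring

theorem exists_backward_orbit (M : Module.End ℂ X) {ν : ℂ} {r : ℝ} (hr : 0 < r) (hν : r < ‖ν‖)
    (k : ℕ) : ∀ x, ((M - ν • (1 : Module.End ℂ X)) ^ k) x = 0 →
      ∃ (y : ℕ → X) (C : ℝ), y 0 = x ∧ (∀ j, M (y (j + 1)) = y j) ∧
        ∀ j, ‖y j‖ ≤ C * r⁻¹ ^ j := by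
  have hν0 : ν ≠ 0 := norm_pos_iff.1 (hr.trans hν)
  induction k with
  | zero =>
    intro x hx
    have hx : x = 0 := by simpa using hx
    exact ⟨fun _ => 0, 0, by simp [hx]⟩
  | succ k ih =>
    intro x hx
    rw [pow_succ, Module.End.mul_apply] at hx
    obtain ⟨y, C, hy0, hy, hC⟩ := ih _ hx
    -- The recursion says `z j = ν z (j+1) + y (j+1)`, so the invariant `M z j = ν z j + y j` makes
    -- `z` a backward orbit of `M`. No inverse of `M` enters.
    let z : ℕ → X := fun j => Nat.rec x (fun j w => ν⁻¹ • (w - y (j + 1))) j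
    have hz : ∀ j, z (j + 1) = ν⁻¹ • (z j - y (j + 1)) := fun j => rfl
    have hMz : ∀ j, M (z j) = ν • z j + y j := by
      intro j
      induction j with
      | zero =>
        rw [hy0]
        simp [z]
      | succ j ihj =>
        rw [hz, map_smul, map_sub, ihj, hy, smul_smul, mul_inv_cancel₀ hν0, one_smul,
          add_sub_cancel_right, smul_smul, inv_mul_cancel₀ hν0, one_smul, sub_add_cancel]
    have hd : 0 < ‖ν‖ - r := sub_pos.2 hν
    refine ⟨z, max ‖x‖ (C / (‖ν‖ - r)), rfl, fun j => ?_, fun j => ?_⟩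
    · rw [hMz (j + 1), hz, smul_smul, mul_inv_cancel₀ hν0, one_smul, sub_add_cancel]
    · induction j with
      | zero => simp [z]
      | succ j ihj =>
        have h2 : C ≤ max ‖x‖ (C / (‖ν‖ - r)) * (‖ν‖ - r) :=
          (div_le_iff₀ hd).1 (le_max_right _ _)
        have h3 : ‖ν‖⁻¹ * (max ‖x‖ (C / (‖ν‖ - r)) * r⁻¹ ^ j
            + (max ‖x‖ (C / (‖ν‖ - r)) * (‖ν‖ - r)) * r⁻¹ ^ (j + 1))
            = max ‖x‖ (C / (‖ν‖ - r)) * r⁻¹ ^ (j + 1) := by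
          have : ‖ν‖ ≠ 0 := norm_ne_zero_iff.2 hν0
          generalize max ‖x‖ (C / (‖ν‖ - r)) = D
          rw [pow_succ]
          generalize r⁻¹ ^ j = p
          field_simp
          ring
        rw [hz, norm_smul, norm_inv, ← h3]
        gcongr
        refine (norm_sub_le _ _).trans (add_le_add ihj ((hC _).trans ?_))
        gcongr

/-- The initial values for which the Green function of `M` decays with rate `r` at both ends. -/
def greenSubmodule (M : Module.End ℂ X) (r : ℝ) : Submodule ℂ X where
  carrier := {x | ∃ g : ℤ → X, (∃ C, ∀ n, ‖g n‖ ≤ C * r ^ (-|n|)) ∧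
    ∀ n, g (n + 1) - M (g n) = if n = -1 then x else 0}
  zero_mem' := ⟨fun _ => 0, ⟨0, by simp⟩, by simp⟩
  add_mem' := by
    rintro x y ⟨g, ⟨C, hC⟩, hg⟩ ⟨h, ⟨D, hD⟩, hh⟩
    refine ⟨g + h, ⟨C + D, fun n => ?_⟩, fun n => ?_⟩
    · rw [add_mul]
      exact (norm_add_le _ _).trans (add_le_add (hC n) (hD n))
    · have h1 := hg n
      have h2 := hh n
      simp only [Pi.add_apply, map_add]
      rw [add_sub_add_comm, h1, h2]
      split_ifs <;> simp
  smul_mem' := by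
    rintro c x ⟨g, ⟨C, hC⟩, hg⟩
    refine ⟨c • g, ⟨‖c‖ * C, fun n => ?_⟩, fun n => ?_⟩
    · rw [mul_assoc]
      exact (norm_smul_le _ _).trans (mul_le_mul_of_nonneg_left (hC n) (norm_nonneg c))
    · simp only [Pi.smul_apply, map_smul]
      rw [← smul_sub, hg n]
      split_ifs <;> simp

theorem zpow_neg_abs_natCast (r : ℝ) (n : ℕ) : r ^ (-|(n : ℤ)|) = r⁻¹ ^ n := by
  rw [Nat.abs_cast, zpow_neg, zpow_natCast, inv_pow]

/-- On stable vectors the Green function is causal: zero before time 0, then `M^n x`. The jump sits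
at step `-1`, so that the response starts at time 0. -/
theorem mem_greenSubmodule_of_norm_pow_le (M : Module.End ℂ X) {r : ℝ} (hr : 0 < r) (x : X)
    (h : ∃ C, ∀ n : ℕ, ‖(M ^ n) x‖ ≤ C * r⁻¹ ^ n) : x ∈ greenSubmodule M r := by
  obtain ⟨C, hC⟩ := h
  have hC0 : 0 ≤ C := by simpa using (norm_nonneg _).trans (hC 0)
  refine ⟨fun n => if 0 ≤ n then (M ^ n.toNat) x else 0, ⟨C, fun n => ?_⟩, fun n => ?_⟩
  · rcases le_or_gt 0 n with hn | hn
    · lift n to ℕ using hn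
      rw [zpow_neg_abs_natCast]
      simpa using hC n
    · simp only [not_le.2 hn, if_false, norm_zero]
      positivity
  · rcases lt_trichotomy n (-1) with hn | hn | hn
    · have h1 : ¬ (0 ≤ n + 1) := by omega
      have h2 : ¬ (0 ≤ n) := by omega
      simp [h1, h2, hn.ne]
    · subst hn
      simp
    · have h1 : 0 ≤ n := by omega
      lift n to ℕ using h1
      have h2 : ((n : ℤ) + 1).toNat = n + 1 := by omega
      have h3 : (n : ℤ) ≠ -1 := by omega
      have h4 : (0 : ℤ) ≤ n + 1 := by omega
      simp [h2, h3, h4, pow_succ']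

/-- On unstable vectors the Green function is anticausal: minus the backward orbit at negative
times, zero from time 0 on. -/
theorem mem_greenSubmodule_of_backward_orbit (M : Module.End ℂ X) {r : ℝ} (hr : 0 < r) (x : X)
    (h : ∃ (y : ℕ → X) (C : ℝ), y 0 = x ∧ (∀ j, M (y (j + 1)) = y j) ∧
        ∀ j, ‖y j‖ ≤ C * r⁻¹ ^ j) : x ∈ greenSubmodule M r := by
  obtain ⟨y, C, hy0, hy, hC⟩ := h
  have hC0 : 0 ≤ C := by simpa using (norm_nonneg _).trans (hC 0)
  refine ⟨fun n => if 0 ≤ n then 0 else - y (-n).toNat, ⟨C, fun n => ?_⟩, fun n => ?_⟩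
  · rcases le_or_gt 0 n with hn | hn
    · simp only [hn, if_true, norm_zero]
      positivity
    · obtain ⟨m, rfl⟩ : ∃ m : ℕ, n = -m := ⟨n.natAbs, by omega⟩
      have h2 : m ≠ 0 := by omega
      rw [abs_neg, zpow_neg_abs_natCast]
      simpa [h2] using hC m
  · rcases lt_trichotomy n (-1) with hn | hn | hn
    · obtain ⟨m, rfl⟩ : ∃ m : ℕ, n = -(m + 1 : ℕ) := ⟨(n + 1).natAbs, by omega⟩
      have h1 : ¬ (0 ≤ -((m + 1 : ℕ) : ℤ) + 1) := by omega
      have h2 : ¬ (0 ≤ -((m + 1 : ℕ) : ℤ)) := by omega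
      have h3 : (-(-((m + 1 : ℕ) : ℤ) + 1)).toNat = m := by omega
      have h4 : (-(-((m + 1 : ℕ) : ℤ))).toNat = m + 1 := by omega
      simp only [h1, h2, h3, h4, hn.ne, if_false, map_neg, hy]
      abel
    · subst hn
      have h1 := hy 0
      rw [hy0] at h1
      simpa using h1
    · have h1 : 0 ≤ n := by omega
      have h2 : 0 ≤ n + 1 := by omega
      have h3 : n ≠ -1 := by omega
      simp [h1, h2, h3]

/-- The generalized eigenspaces span. Strictly inside the gap condition the polynomial factors are
absorbed by the room between `‖ν‖` and the extremal circle. On the circles themselves there is no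
room, and semisimplicity removes the polynomial factors. -/
theorem greenSubmodule_eq_top [FiniteDimensional ℂ X] (M : Module.End ℂ X) {r : ℝ} (hr : 1 < r)
    (gap : ∀ ν : ℂ, M.HasEigenvalue ν → ‖ν‖ ≤ 1 / r ∨ r ≤ ‖ν‖)
    (semisimple : ∀ ν : ℂ, ‖ν‖ = 1 / r ∨ ‖ν‖ = r → M.maxGenEigenspace ν = M.eigenspace ν) :
    greenSubmodule M r = ⊤ := by
  have hr0 : 0 < r := one_pos.trans hr
  rw [eq_top_iff, ← Module.End.iSup_maxGenEigenspace_eq_top M]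
  refine iSup_le fun ν => ?_
  by_cases hν : M.HasEigenvalue ν
  · intro x hx
    rw [one_div] at gap semisimple
    by_cases hs : ‖ν‖ = r⁻¹ ∨ ‖ν‖ = r
    · rw [semisimple ν hs, Module.End.mem_eigenspace_iff] at hx
      have hpow : ∀ n : ℕ, (M ^ n) x = ν ^ n • x := fun n => by
        induction n with
        | zero => simp
        | succ n ih => rw [pow_succ, Module.End.mul_apply, hx, map_smul, ih, smul_smul, pow_succ']
      rcases hs with hs | hs
      · refine mem_greenSubmodule_of_norm_pow_le M hr0 x ⟨‖x‖, fun n => ?_⟩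
        rw [hpow, norm_smul, norm_pow, hs, mul_comm]
      · have hν0 : ν ≠ 0 := norm_pos_iff.1 (hs ▸ hr0)
        refine mem_greenSubmodule_of_backward_orbit M hr0 x
          ⟨fun j => (ν⁻¹) ^ j • x, ‖x‖, by simp, fun j => ?_, fun j => ?_⟩
        · rw [map_smul, hx, smul_smul, pow_succ, mul_assoc, inv_mul_cancel₀ hν0, mul_one]
        · rw [norm_smul, norm_pow, norm_inv, hs, mul_comm]
    · rw [not_or] at hs
      obtain ⟨k, hk⟩ := (Module.End.mem_maxGenEigenspace M ν x).1 hx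
      rcases gap ν hν with h | h
      · exact mem_greenSubmodule_of_norm_pow_le M hr0 x
          (exists_norm_pow_apply_le M (lt_of_le_of_ne h hs.1) k x hk)
      · exact mem_greenSubmodule_of_backward_orbit M hr0 x
          (exists_backward_orbit M hr0 (lt_of_le_of_ne h (Ne.symm hs.2)) k x hk)
  · have : M.maxGenEigenspace ν = ⊥ := by
      by_contra h
      obtain ⟨x, hx, hx0⟩ := Submodule.exists_mem_ne_zero_of_ne_bot h
      obtain ⟨k, hk⟩ := (Module.End.mem_maxGenEigenspace M ν x).1 hx
      have hinj : Function.Injective (M - ν • (1 : Module.End ℂ X)) := by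
        rw [← LinearMap.ker_eq_bot, LinearMap.ker_eq_bot']
        intro y hy
        by_contra hy0
        exact hν (Module.End.hasEigenvalue_of_hasEigenvector
          (Module.End.hasEigenvector_iff.2 ⟨Module.End.mem_eigenspace_iff.2
            (sub_eq_zero.1 (by simpa using hy)), hy0⟩))
      rw [Module.End.pow_apply] at hk
      exact hx0 (hinj.iterate k (hk.trans (by rw [← Module.End.pow_apply, map_zero])))
    rw [this]
    exact bot_le

/-- A bounded sequence with `V(n+1) = ν V(n)` vanishes if `ν` is not on the unit circle. -/
theorem eq_zero_of_succ_eq_smul {ν : ℂ} (hν : ‖ν‖ ≠ 1) (V : ℤ → X) (hb : ∃ C, ∀ n, ‖V n‖ ≤ C)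
    (h : ∀ n, V (n + 1) = ν • V n) (n : ℤ) : V n = 0 := by
  obtain ⟨C, hC⟩ := hb
  have hpow : ∀ (j : ℕ) (n : ℤ), V (n + j) = ν ^ j • V n := fun j n => by
    induction j with
    | zero => simp
    | succ j ih => rw [Nat.cast_succ, ← add_assoc, h, ih, smul_smul, pow_succ']
  rcases lt_or_gt_of_ne hν with h1 | h1
  · have h2 : ∀ j : ℕ, ‖V n‖ ≤ ‖ν‖ ^ j * C := fun j => by
      have := hpow j (n - j)
      rw [sub_add_cancel] at this
      rw [this, norm_smul, norm_pow]
      gcongr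
      exact hC _
    have h3 := (tendsto_pow_atTop_nhds_zero_of_lt_one (norm_nonneg ν) h1).mul_const C
    rw [zero_mul] at h3
    exact norm_le_zero_iff.1 (ge_of_tendsto' h3 h2)
  · have h2 : ∀ j : ℕ, ‖V n‖ ≤ (‖ν‖⁻¹) ^ j * C := fun j => by
      have := hC (n + j)
      rw [hpow, norm_smul, norm_pow] at this
      rw [inv_pow, ← div_eq_inv_mul, le_div_iff₀ (by positivity), mul_comm]
      exact this
    have h3 := (tendsto_pow_atTop_nhds_zero_of_lt_one (by positivity)
      (inv_lt_one_of_one_lt₀ h1)).mul_const C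
    rw [zero_mul] at h3
    exact norm_le_zero_iff.1 (ge_of_tendsto' h3 h2)

theorem norm_end_apply_bounded [FiniteDimensional ℂ X] (M : Module.End ℂ X) (V : ℤ → X)
    (hb : ∃ C, ∀ n, ‖V n‖ ≤ C) : ∃ C, ∀ n, ‖M (V n)‖ ≤ C := by
  obtain ⟨C, hC⟩ := hb
  refine ⟨‖LinearMap.toContinuousLinearMap M‖ * C, fun n => ?_⟩
  exact ((LinearMap.toContinuousLinearMap M).le_opNorm (V n)).trans
    (mul_le_mul_of_nonneg_left (hC n) (norm_nonneg _))

/-- A linear map without eigenvalues on the unit circle has no nontrivial bounded orbit. -/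
theorem eq_zero_of_bounded_orbit [FiniteDimensional ℂ X] (M : Module.End ℂ X)
    (hM : ∀ ν : ℂ, M.HasEigenvalue ν → ‖ν‖ ≠ 1) (V : ℤ → X) (hb : ∃ C, ∀ n, ‖V n‖ ≤ C)
    (h : ∀ n, V (n + 1) = M (V n)) (n : ℤ) : V n = 0 := by
  -- Factors of the characteristic polynomial are peeled off one at a time: `(M - ν) V` is again a
  -- bounded orbit, killed by the remaining factors, hence zero, which leaves `V (n+1) = ν V n`.
  -- Cayley–Hamilton starts the argument.
  have key : ∀ (s : Multiset ℂ), (∀ ν ∈ s, ‖ν‖ ≠ 1) → ∀ V : ℤ → X, (∃ C, ∀ n, ‖V n‖ ≤ C) →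
      (∀ n, V (n + 1) = M (V n)) →
      (∀ n, Polynomial.aeval M (s.map fun ν => Polynomial.X - Polynomial.C ν).prod (V n) = 0) →
      ∀ n, V n = 0 := by
    intro s
    induction s using Multiset.induction with
    | empty => intro _ V _ _ h n; simpa using h n
    | cons ν s ih =>
      intro hs V hb hV hp
      obtain ⟨C, hC⟩ := hb
      obtain ⟨D, hD⟩ := norm_end_apply_bounded M V ⟨C, hC⟩
      refine eq_zero_of_succ_eq_smul (hs ν (Multiset.mem_cons_self _ _)) V ⟨C, hC⟩ fun n => ?_
      have := ih (fun μ hμ => hs μ (Multiset.mem_cons_of_mem hμ)) (fun n => M (V n) - ν • V n)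
        ⟨D + ‖ν‖ * C, fun n => (norm_sub_le _ _).trans (add_le_add (hD n)
          ((norm_smul_le _ _).trans (mul_le_mul_of_nonneg_left (hC n) (norm_nonneg _))))⟩
        (fun n => by simp [hV]) (fun n => by
          have := hp n
          rw [Multiset.map_cons, Multiset.prod_cons, mul_comm, map_mul,
            Module.End.mul_apply] at this
          simpa using this) n
      rw [hV]
      exact sub_eq_zero.1 this
  have hsplit := IsAlgClosed.splits M.charpoly
  have hroots := hsplit.eq_prod_roots
  rw [(LinearMap.charpoly_monic M).leadingCoeff, Polynomial.C_1, one_mul] at hroots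
  refine key M.charpoly.roots (fun ν hν => hM ν ?_) V hb h (fun n => ?_) n
  · exact (Module.End.hasEigenvalue_iff_isRoot_charpoly M ν).2
      (Polynomial.isRoot_of_mem_roots hν)
  · rw [← hroots, LinearMap.aeval_self_charpoly]
    rfl

end Green

/-- The Green function on `ℤ` of a linear map without nontrivial bounded orbits. -/
structure IsGreenFunction {E : Type*} [NormedAddCommGroup E] [NormedSpace ℝ E]
    (A : E →L[ℝ] E) (r K : ℝ) (g : ℤ → E →L[ℝ] E) : Prop where
  one_lt : 1 < r
  pos : 0 < K
  norm_le : ∀ n, ‖g n‖ ≤ K * r ^ (-|n|)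
  step : ∀ n e, g (n + 1) e - A (g n e) = if n = -1 then e else 0
  eq_zero : ∀ V : ℤ → E, (∃ C, ∀ n, ‖V n‖ ≤ C) → (∀ n, V (n + 1) = A (V n)) → ∀ n, V n = 0

/-! ### Descent of the Green function to the real map. -/

section Complexification

variable {k : ℕ}

/-- The real part of a vector of `ℂ^k`. -/
noncomputable def rePart (z : Fin k → ℂ) : EuclideanSpace ℝ (Fin k) :=
  WithLp.toLp 2 fun i => (z i).re

@[simp] theorem rePart_apply (z : Fin k → ℂ) (i : Fin k) : rePart z i = (z i).re := rfl

theorem rePart_sub (z w : Fin k → ℂ) : rePart (z - w) = rePart z - rePart w := by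
  ext i; simp

theorem norm_rePart_le (z : Fin k → ℂ) : ‖rePart z‖ ≤ k * ‖z‖ := by
  have h : rePart z = ∑ i, EuclideanSpace.single i (rePart z i) := by
    ext j
    simp
  rw [h]
  refine (norm_sum_le _ _).trans ?_
  have : ∀ i ∈ (Finset.univ : Finset (Fin k)),
      ‖EuclideanSpace.single i (rePart z i)‖ ≤ ‖z‖ := fun i _ => by
    rw [PiLp.norm_single, rePart_apply]
    exact (Complex.abs_re_le_norm _).trans (norm_le_pi_norm z i)
  simpa using Finset.sum_le_card_nsmul _ _ _ this

theorem apply_eq_sum (A : EuclideanSpace ℝ (Fin k) →L[ℝ] EuclideanSpace ℝ (Fin k))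
    (x : EuclideanSpace ℝ (Fin k)) (i : Fin k) :
    A x i = ∑ j, A (EuclideanSpace.single j (1 : ℝ)) i * x j := by
  have h : x = ∑ j, x j • EuclideanSpace.single j (1 : ℝ) := by
    ext l
    simp [Pi.single_apply]
  conv_lhs => rw [h, map_sum]
  simp [mul_comm]

theorem rePart_complexification (A : EuclideanSpace ℝ (Fin k) →L[ℝ] EuclideanSpace ℝ (Fin k))
    (z : Fin k → ℂ) : rePart (complexification A z) = A (rePart z) := by
  ext i
  rw [apply_eq_sum]
  simp [complexification, Matrix.toLin'_apply, Matrix.mulVec, dotProduct]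

theorem complexification_ofReal (A : EuclideanSpace ℝ (Fin k) →L[ℝ] EuclideanSpace ℝ (Fin k))
    (x : EuclideanSpace ℝ (Fin k)) :
    complexification A (fun i => (x i : ℂ)) = fun i => ((A x i : ℝ) : ℂ) := by
  ext i
  rw [apply_eq_sum]
  simp [complexification, Matrix.toLin'_apply, Matrix.mulVec, dotProduct]

/-- A hyperbolic linear map has a Green function with the decay rate of its spectral gap. -/
theorem IsHyperbolic.exists_isGreenFunction
    {A : EuclideanSpace ℝ (Fin k) →L[ℝ] EuclideanSpace ℝ (Fin k)} {r : ℝ}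
    (hA : IsHyperbolic A r) : ∃ K g, IsGreenFunction A r K g := by
  have htop := greenSubmodule_eq_top (complexification A) hA.one_lt hA.gap hA.semisimple
  have hr0 : 0 < r := one_pos.trans hA.one_lt
  have hj : ∀ j : Fin k, (Pi.single j 1 : Fin k → ℂ) ∈ greenSubmodule (complexification A) r :=
    fun j => htop ▸ Submodule.mem_top
  choose h hb hs using hj
  choose C hC using hb
  -- The columns are real parts of complex Green functions at the basis vectors; taking real parts
  -- intertwines the complexification with `A`.
  let g : ℤ → EuclideanSpace ℝ (Fin k) →L[ℝ] EuclideanSpace ℝ (Fin k) := fun n =>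
    ∑ j, (EuclideanSpace.proj j : EuclideanSpace ℝ (Fin k) →L[ℝ] ℝ).smulRight (rePart (h j n))
  have hg : ∀ n e, g n e = ∑ j, e j • rePart (h j n) := fun n e => by
    simp [g]
  refine ⟨1 + ∑ j, ‖(EuclideanSpace.proj j : EuclideanSpace ℝ (Fin k) →L[ℝ] ℝ)‖ * (k * |C j|), g,
    hA.one_lt, by positivity, fun n => ?_, fun n e => ?_, fun V hb hV n => ?_⟩
  · refine (norm_sum_le _ _).trans ?_
    rw [add_mul, Finset.sum_mul]
    refine le_add_of_nonneg_of_le (by positivity) (Finset.sum_le_sum fun j _ => ?_)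
    rw [ContinuousLinearMap.norm_smulRight_apply, mul_assoc, mul_assoc]
    gcongr
    refine (norm_rePart_le _).trans ?_
    gcongr
    refine (hC j n).trans ?_
    gcongr
    exact le_abs_self _
  · rw [hg, hg, map_sum, ← Finset.sum_sub_distrib]
    have : ∀ j, e j • rePart (h j (n + 1)) - A (e j • rePart (h j n))
        = if n = -1 then e j • EuclideanSpace.single j (1 : ℝ) else 0 := fun j => by
      rw [map_smul, ← rePart_complexification, ← smul_sub, ← rePart_sub, hs j n]
      split_ifs
      · congr 1
        ext i
        by_cases hij : i = j
        · subst hij; simp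
        · simp [hij]
      · ext i; simp
    rw [Finset.sum_congr rfl fun j _ => this j]
    split_ifs
    · ext l
      simp [Pi.single_apply]
    · simp
  · obtain ⟨D, hD⟩ := hb
    have h0 := eq_zero_of_bounded_orbit (complexification A) (fun ν hν h1 => by
        have h2 := hA.gap ν hν
        rw [h1] at h2
        have h3 := hA.one_lt
        rcases h2 with h2 | h2
        · rw [le_div_iff₀ hr0] at h2; linarith
        · linarith)
      (fun n i => ((V n i : ℝ) : ℂ)) ⟨D, fun n => (pi_norm_le_iff_of_nonneg
        ((norm_nonneg _).trans (hD 0))).2 fun i => by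
          rw [Complex.norm_real]
          exact (PiLp.norm_apply_le (V n) i).trans (hD n)⟩
      (fun n => by rw [complexification_ofReal, hV]) n
    ext i
    have := congrFun h0 i
    simpa using this

end Complexification

/-! ### Representation of bounded sequences by the Green function. -/

section Convolution

variable {E : Type*} [NormedAddCommGroup E] [NormedSpace ℝ E]

theorem summable_zpow_neg_abs {q : ℝ} (hq : 1 < q) : Summable fun j : ℤ => q ^ (-|j|) := by
  have h : Summable fun n : ℕ => q⁻¹ ^ n :=
    summable_geometric_of_lt_one (by positivity) (inv_lt_one_of_one_lt₀ hq)
  refine Summable.of_nat_of_neg ?_ ?_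
  · exact h.congr fun n => (zpow_neg_abs_natCast q n).symm
  · exact h.congr fun n => by rw [abs_neg, zpow_neg_abs_natCast]

theorem summable_zpow_neg_abs_sub {q : ℝ} (hq : 1 < q) (n : ℤ) :
    Summable fun j : ℤ => q ^ (-|n - 1 - j|) :=
  (summable_zpow_neg_abs hq).comp_injective (i := fun j : ℤ => n - 1 - j)
    fun a b h => by simpa using h

theorem tsum_zpow_neg_abs_sub {q : ℝ} (n : ℤ) :
    ∑' j : ℤ, q ^ (-|n - 1 - j|) = ∑' j : ℤ, q ^ (-|j|) :=
  (Equiv.subLeft (n - 1)).tsum_eq (fun j : ℤ => q ^ (-|j|))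

variable {A : E →L[ℝ] E} {r K : ℝ} {g : ℤ → E →L[ℝ] E}

theorem IsGreenFunction.summable [CompleteSpace E] (hg : IsGreenFunction A r K g) (H : ℤ → E)
    (hH : ∃ C, ∀ n, ‖H n‖ ≤ C) (n : ℤ) : Summable fun j => g (n - 1 - j) (H j) := by
  obtain ⟨C, hC⟩ := hH
  refine Summable.of_norm_bounded (((summable_zpow_neg_abs_sub hg.one_lt n).mul_left K).mul_right C)
    fun j => ?_
  refine ((g _).le_opNorm _).trans (mul_le_mul (hg.norm_le _) (hC j) (norm_nonneg _) ?_)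
  exact (norm_nonneg _).trans (hg.norm_le _)

theorem IsGreenFunction.convolution_bounded (hg : IsGreenFunction A r K g) (H : ℤ → E)
    (hH : ∃ C, ∀ n, ‖H n‖ ≤ C) : ∃ C, ∀ n, ‖∑' j, g (n - 1 - j) (H j)‖ ≤ C := by
  obtain ⟨C, hC⟩ := hH
  refine ⟨∑' j : ℤ, K * r ^ (-|j|) * C, fun n => ?_⟩
  have h1 : HasSum (fun j => K * r ^ (-|n - 1 - j|) * C) (∑' j : ℤ, K * r ^ (-|j|) * C) := by
    rw [tsum_mul_right, tsum_mul_left, ← tsum_zpow_neg_abs_sub n]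
    exact ((summable_zpow_neg_abs_sub hg.one_lt n).hasSum.mul_left K).mul_right C
  refine tsum_of_norm_bounded h1 fun j => ?_
  refine ((g _).le_opNorm _).trans (mul_le_mul (hg.norm_le _) (hC j) (norm_nonneg _) ?_)
  exact (norm_nonneg _).trans (hg.norm_le _)

theorem IsGreenFunction.convolution_step [CompleteSpace E] (hg : IsGreenFunction A r K g)
    (H : ℤ → E) (hH : ∃ C, ∀ n, ‖H n‖ ≤ C) (n : ℤ) :
    ∑' j, g (n + 1 - 1 - j) (H j) - A (∑' j, g (n - 1 - j) (H j)) = H n := by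
  have h1 := hg.summable H hH n
  have h2 := hg.summable H hH (n + 1)
  rw [A.map_tsum h1, ← h2.tsum_sub (h1.mapL A), tsum_eq_single n]
  · have := hg.step (n - 1 - n) (H n)
    rw [if_pos (by ring)] at this
    convert this using 4
    ring
  · intro j hj
    have := hg.step (n - 1 - j) (H j)
    rw [if_neg (by omega)] at this
    convert this using 4
    ring

/-- Both sides are bounded and have the same residual, so their difference is a bounded orbit of
`A`, hence zero. -/
theorem IsGreenFunction.eq_convolution [CompleteSpace E] (hg : IsGreenFunction A r K g) (V : ℤ → E)
    (hV : ∃ C, ∀ n, ‖V n‖ ≤ C) (n : ℤ) :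
    V n = ∑' j, g (n - 1 - j) (V (j + 1) - A (V j)) := by
  obtain ⟨C, hC⟩ := hV
  have hH : ∃ C, ∀ n, ‖V (n + 1) - A (V n)‖ ≤ C := ⟨C + ‖A‖ * C, fun n =>
    (norm_sub_le _ _).trans (add_le_add (hC _) ((A.le_opNorm _).trans
      (mul_le_mul_of_nonneg_left (hC _) (norm_nonneg _))))⟩
  obtain ⟨D, hD⟩ := hg.convolution_bounded (fun j => V (j + 1) - A (V j)) hH
  refine sub_eq_zero.1 (hg.eq_zero (fun n => V n - ∑' j, g (n - 1 - j) (V (j + 1) - A (V j)))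
    ⟨C + D, fun n => (norm_sub_le _ _).trans (add_le_add (hC n) (hD n))⟩ (fun n => ?_) n)
  have := hg.convolution_step (fun j => V (j + 1) - A (V j)) hH n
  rw [sub_eq_iff_eq_add] at this
  rw [this, map_sub]
  abel

theorem IsGreenFunction.bijective [CompleteSpace E] (hg : IsGreenFunction A r K g) :
    Function.Bijective (seqOp (BoundedContinuousFunction.const ℤ A)) := by
  constructor
  · refine (injective_iff_map_eq_zero _).2 fun V hV => ?_
    ext1 n
    refine hg.eq_zero V ⟨‖V‖, V.norm_coe_le_norm⟩ (fun n => ?_) n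
    exact sub_eq_zero.1 (DFunLike.congr_fun hV n)
  · intro H
    have hH : ∃ C, ∀ n, ‖H n‖ ≤ C := ⟨‖H‖, H.norm_coe_le_norm⟩
    exact ⟨bddSeq _ (hg.convolution_bounded H hH), by ext1 n; exact hg.convolution_step H hH n⟩

/-- The form in which the representation is used: a pointwise bound on the residual becomes a
pointwise bound on `V`. The majorant `c` is left free so that each weight can be handled by its own
geometric series. -/
theorem IsGreenFunction.norm_le_tsum [CompleteSpace E] (hg : IsGreenFunction A r K g) (V : ℤ → E)
    (hV : ∃ C, ∀ n, ‖V n‖ ≤ C) (b : ℤ → ℝ) (hb : ∀ n, ‖V (n + 1) - A (V n)‖ ≤ b n) (n : ℤ)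
    {c : ℤ → ℝ} {s : ℝ} (hc : HasSum c s) (hbc : ∀ j, r ^ (-|j|) * b (n - 1 - j) ≤ c j) :
    ‖V n‖ ≤ K * s := by
  have hr0 : 0 < r := one_pos.trans hg.one_lt
  rw [hg.eq_convolution V hV n]
  have hc' : HasSum (fun j => K * c (n - 1 - j)) (K * s) :=
    ((Equiv.subLeft (n - 1)).hasSum_iff.2 hc).mul_left K
  refine tsum_of_norm_bounded hc' fun j => ?_
  have h1 := hbc (n - 1 - j)
  rw [sub_sub_cancel] at h1
  refine ((g _).le_opNorm _).trans ((mul_le_mul (hg.norm_le _) (hb j) (norm_nonneg _) ?_).trans ?_)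
  · exact (norm_nonneg _).trans (hg.norm_le _)
  · rw [mul_assoc]
    exact mul_le_mul_of_nonneg_left h1 hg.pos.le

end Convolution

/-! ### Exponential decay of orbits at the sharp rate. -/

section Decay

variable {E : Type*} [NormedAddCommGroup E] [NormedSpace ℝ E] [CompleteSpace E]

/-- The absorption argument: the supremum, known to be finite, satisfies `S ≤ D + S / 2`. -/
theorem le_two_mul_of_forall_bound_improves {ι : Type*} [Nonempty ι] (b : ι → ℝ) (D : ℝ)
    (hb : ∃ C, ∀ n, b n ≤ C) (h : ∀ S, (∀ n, b n ≤ S) → ∀ n, b n ≤ D + S / 2) (n : ι) :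
    b n ≤ 2 * D := by
  obtain ⟨C, hC⟩ := hb
  have hbdd : BddAbove (Set.range b) := ⟨C, by rintro _ ⟨n, rfl⟩; exact hC n⟩
  have h1 : (⨆ n, b n) ≤ D + (⨆ n, b n) / 2 := ciSup_le (h _ (le_ciSup hbdd))
  have h2 := le_ciSup hbdd n
  linarith

theorem abs_le_abs_sub_one_sub_add (n j : ℤ) : |n| ≤ |n - 1 - j| + |j| + 1 := by
  rcases abs_cases n with h1 | h1 <;> rcases abs_cases j with h2 | h2 <;>
    rcases abs_cases (n - 1 - j) with h3 | h3 <;> omega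

variable {A : E →L[ℝ] E} {r K : ℝ} {g : ℤ → E →L[ℝ] E}

/-- Convolution with the Green function has norm at most `K * ρ * S` in the sup norm with weight `ρ
^ (-|n|)`, because `ρ < r`. A residual part `ε * ‖V n‖` with small `ε` can then be absorbed. -/
theorem IsGreenFunction.exists_decay_of_le (hg : IsGreenFunction A r K g) {ρ : ℝ} (hρ : 1 < ρ)
    (hρr : ρ < r) : ∃ ε > 0, ∀ c, 0 ≤ c → ∃ D, ∀ V : ℤ → E, (∃ C, ∀ n, ‖V n‖ ≤ C) →
      (∀ n, ‖V (n + 1) - A (V n)‖ ≤ c * ρ ^ (-|n|) + ε * ‖V n‖) →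
      ∀ n, ‖V n‖ ≤ D * ρ ^ (-|n|) := by
  have hρ0 : 0 < ρ := one_pos.trans hρ
  have hr0 : 0 < r := one_pos.trans hg.one_lt
  have hK := hg.pos
  have hq : 1 < r / ρ := (one_lt_div hρ0).2 hρr
  have hsum := summable_zpow_neg_abs hq
  set S := ∑' j : ℤ, (r / ρ) ^ (-|j|) with hS
  have hSpos : 0 < S := hsum.tsum_pos (fun j => by positivity) 0 (by simp)
  -- This `ε` times the norm of the weighted convolution is `1 / 2`.
  refine ⟨1 / (2 * (K * ρ * S)), by positivity, fun c hc => ⟨2 * (K * ρ * S * c),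
    fun V hV hstep n => ?_⟩⟩
  obtain ⟨C, hC⟩ := hV
  -- Since `V` is only known to be bounded, its weighted supremum might be infinite. Adding `η` to
  -- the weight makes it finite, and the final bound survives `η → 0`.
  have key : ∀ η > 0, ‖V n‖ ≤ 2 * (K * ρ * S * c) * (ρ ^ (-|n|) + η) := by
    intro η hη
    have hw : ∀ n : ℤ, 0 < ρ ^ (-|n|) + η := fun n => by positivity
    rw [← div_le_iff₀ (hw n)]
    refine le_two_mul_of_forall_bound_improves (fun n => ‖V n‖ / (ρ ^ (-|n|) + η)) _
      ⟨C / η, fun n => ?_⟩ (fun T hT n => ?_) n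
    · refine div_le_div₀ ((norm_nonneg _).trans (hC n)) (hC n) hη ?_
      have : 0 < ρ ^ (-|n|) := by positivity
      linarith
    · rw [div_le_iff₀ (hw n)]
      have hT0 : 0 ≤ T := le_trans (by positivity) (hT 0)
      have hT' : ∀ n, ‖V n‖ ≤ T * (ρ ^ (-|n|) + η) := fun n => (div_le_iff₀ (hw n)).1 (hT n)
      have h1 := hg.norm_le_tsum V ⟨C, hC⟩
        (fun n => (c + 1 / (2 * (K * ρ * S)) * T) * (ρ ^ (-|n|) + η)) (fun n => by
          refine (hstep n).trans ?_
          rw [add_mul, mul_assoc _ T]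
          gcongr
          · linarith
          · exact hT' n) n
        (c := fun j => (c + 1 / (2 * (K * ρ * S)) * T) * (ρ * (ρ ^ (-|n|) + η)) * (r / ρ) ^ (-|j|))
        (hsum.hasSum.mul_left _) (fun j => by
          have h2 : ρ ^ (-|n - 1 - j|) ≤ ρ ^ |j| * ρ * ρ ^ (-|n|) := by
            rw [← zpow_add_one₀ hρ0.ne', ← zpow_add₀ hρ0.ne']
            refine zpow_le_zpow_right₀ hρ.le ?_
            linarith [abs_le_abs_sub_one_sub_add n j]
          have h3 : (1 : ℝ) ≤ ρ ^ |j| * ρ := by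
            rw [← zpow_add_one₀ hρ0.ne']
            exact one_le_zpow₀ hρ.le (by positivity)
          have h4 : (r / ρ) ^ (-|j|) = r ^ (-|j|) * ρ ^ |j| := by
            rw [div_zpow, zpow_neg ρ, div_inv_eq_mul]
          rw [h4]
          have h5 : ρ ^ (-|n - 1 - j|) + η ≤ ρ ^ |j| * ρ * (ρ ^ (-|n|) + η) := by
            nlinarith
          calc _ ≤ r ^ (-|j|) * ((c + 1 / (2 * (K * ρ * S)) * T)
                * (ρ ^ |j| * ρ * (ρ ^ (-|n|) + η))) := by gcongr
            _ = _ := by ring)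
      refine h1.trans (le_of_eq ?_)
      rw [← hS]
      field_simp
  have hlim : Tendsto (fun η => 2 * (K * ρ * S * c) * (ρ ^ (-|n|) + η)) (𝓝[>] 0)
      (𝓝 (2 * (K * ρ * S * c) * (ρ ^ (-|n|) + 0))) :=
    ((tendsto_id.const_add _).const_mul _).mono_left nhdsWithin_le_nhds
  rw [add_zero] at hlim
  exact ge_of_tendsto hlim (eventually_mem_nhdsWithin.mono fun η hη => key η hη)

/-- The convolution of `r ^ (-|n|)` with the faster `τ ^ (-|n|)` still decays at the rate `r`: the
triangle inequality moves the factor `r ^ (-|n|)` out, and a series with ratio `r / τ` remains. -/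
theorem IsGreenFunction.decay_of_fast_decay (hg : IsGreenFunction A r K g) {τ : ℝ} (hτ : r < τ)
    (c : ℝ) (hc : 0 ≤ c) (V : ℤ → E) (hV : ∃ C, ∀ n, ‖V n‖ ≤ C)
    (hstep : ∀ n, ‖V (n + 1) - A (V n)‖ ≤ c * τ ^ (-|n|)) :
    ∃ D, ∀ n, ‖V n‖ ≤ D * r ^ (-|n|) := by
  have hr0 : 0 < r := one_pos.trans hg.one_lt
  have hτ0 : 0 < τ := hr0.trans hτ
  have hq : 1 < τ / r := (one_lt_div hr0).2 hτ
  refine ⟨K * (c * r * ∑' j : ℤ, (τ / r) ^ (-|j|)), fun n => ?_⟩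
  have h1 := hg.norm_le_tsum V hV _ hstep n
    (c := fun j => c * r * r ^ (-|n|) * (τ / r) ^ (-|n - 1 - j|))
    ((summable_zpow_neg_abs_sub hq n).hasSum.mul_left _) (fun j => by
      have h2 : r ^ (-|j|) ≤ r ^ |n - 1 - j| * r * r ^ (-|n|) := by
        rw [← zpow_add_one₀ hr0.ne', ← zpow_add₀ hr0.ne']
        refine zpow_le_zpow_right₀ hg.one_lt.le ?_
        linarith [abs_le_abs_sub_one_sub_add n j]
      have h4 : (τ / r) ^ (-|n - 1 - j|) = τ ^ (-|n - 1 - j|) * r ^ |n - 1 - j| := by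
        rw [div_zpow, zpow_neg r, div_inv_eq_mul]
      rw [h4]
      calc _ ≤ r ^ |n - 1 - j| * r * r ^ (-|n|) * (c * τ ^ (-|n - 1 - j|)) := by gcongr
        _ = _ := by ring)
  rw [tsum_zpow_neg_abs_sub] at h1
  refine h1.trans (le_of_eq ?_)
  ring

theorem exists_le_mul_of_eventually_cofinite (f w : ℤ → ℝ) (hw : ∀ n, 0 < w n)
    (P : ℤ → Prop) (hP : ∀ᶠ n in cofinite, P n) : ∃ c, 0 ≤ c ∧ ∀ n, P n ∨ f n ≤ c * w n := by
  have hfin : {n | ¬ P n}.Finite := hP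
  obtain ⟨c, hc⟩ := (hfin.image fun n => f n / w n).bddAbove
  refine ⟨max c 0, le_max_right _ _, fun n => or_iff_not_imp_left.2 fun hn => ?_⟩
  rw [← div_le_iff₀ (hw n)]
  exact (hc ⟨n, hn, rfl⟩).trans (le_max_left _ _)

/-- A bounded orbit of a quadratic perturbation of `A` which stays in a small ball near both ends
decays with the rate of the Green function. -/
theorem IsGreenFunction.exists_decay_of_sq_le (hg : IsGreenFunction A r K g) (c : ℝ)
    (hc : 0 ≤ c) : ∃ ε > 0, ∀ V : ℤ → E, (∃ C, ∀ n, ‖V n‖ ≤ C) →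
      (∀ n, ‖V (n + 1) - A (V n)‖ ≤ c * ‖V n‖ ^ 2) → (∀ᶠ n in cofinite, ‖V n‖ ≤ ε) →
      ∃ D > 0, ∀ n, ‖V n‖ ≤ D * r ^ (-|n|) := by
  have hr := hg.one_lt
  have hr0 : 0 < r := one_pos.trans hr
  -- `ρ < r` permits the absorption argument, and `ρ ^ 2 > r` makes the quadratic residual decay
  -- fast enough for the rate `r` afterwards.
  obtain ⟨ρ, h1, h2⟩ := exists_between (show √r < r from by
    rw [Real.sqrt_lt' hr0]; nlinarith)
  have hρ : 1 < ρ := lt_trans (by rw [Real.lt_sqrt zero_le_one]; linarith) h1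
  have hρ2 : r < ρ ^ 2 := (Real.sqrt_lt' (one_pos.trans hρ)).1 h1
  obtain ⟨ε, hε, h⟩ := hg.exists_decay_of_le hρ h2
  refine ⟨ε / (c + 1), by positivity, fun V hV hstep hsmall => ?_⟩
  -- The finitely many times at which `V` is not small are paid for by the exponential term of the
  -- residual bound.
  obtain ⟨c', hc', hP⟩ := exists_le_mul_of_eventually_cofinite (fun n => c * ‖V n‖ ^ 2)
    (fun n => ρ ^ (-|n|)) (fun n => by positivity) _ hsmall
  obtain ⟨D, hD⟩ := h c' hc'
  have hD' := hD V hV fun n => by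
    refine (hstep n).trans ?_
    rcases hP n with hn | hn
    · have h3 : c * ‖V n‖ ≤ ε := by
        rw [le_div_iff₀ (by positivity)] at hn
        nlinarith [norm_nonneg (V n)]
      have h4 : 0 ≤ c' * ρ ^ (-|n|) := by positivity
      nlinarith [norm_nonneg (V n)]
    · have : 0 ≤ ε * ‖V n‖ := by positivity
      linarith
  obtain ⟨D', hD''⟩ := hg.decay_of_fast_decay hρ2 (c * D ^ 2) (by positivity) V hV fun n => by
    refine (hstep n).trans ?_
    have h5 := pow_le_pow_left₀ (norm_nonneg _) (hD' n) 2
    have h6 : (ρ ^ 2) ^ (-|n|) = (ρ ^ (-|n|)) ^ 2 := by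
      rw [← zpow_natCast, ← zpow_natCast, ← zpow_mul, ← zpow_mul, mul_comm]
    rw [h6, mul_assoc, ← mul_pow]
    gcongr
  refine ⟨|D'| + 1, by positivity, fun n => (hD'' n).trans ?_⟩
  gcongr
  exact (le_abs_self _).trans (by linarith)

end Decay

/-! ### A priori bounds and their stability. -/

section APriori

variable {E : Type*} [NormedAddCommGroup E] [NormedSpace ℝ E]

/-- Bounded sequences are controlled by their image under the sequence operator of `B`. -/
def HasAPrioriBound (B : ℤ → E →L[ℝ] E) (K : ℝ) : Prop :=
  ∀ V : ℤ → E, (∃ C, ∀ n, ‖V n‖ ≤ C) → ∀ h, 0 ≤ h → (∀ n, ‖V (n + 1) - B n (V n)‖ ≤ h) →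
    ∀ n, ‖V n‖ ≤ K * h

theorem exists_hasAPrioriBound [CompleteSpace E] (B : ℤ →ᵇ (E →L[ℝ] E))
    (hB : Function.Bijective (seqOp B)) : ∃ K > 0, HasAPrioriBound B K := by
  obtain ⟨K, hK, h⟩ := exists_bound_of_bijective B hB
  refine ⟨K, hK, fun V hV d hd hVd n => ?_⟩
  refine ((bddSeq V hV).norm_coe_le_norm n).trans ((h _).trans ?_)
  gcongr
  exact (BoundedContinuousFunction.norm_le hd).2 hVd

theorem HasAPrioriBound.norm_le_of_perturbation {B : ℤ → E →L[ℝ] E} {K κ : ℝ}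
    (hB : HasAPrioriBound B K) (hκ : κ * (2 * K) ≤ 1) (hκ0 : 0 ≤ κ) (V : ℤ → E)
    (hV : ∃ C, ∀ n, ‖V n‖ ≤ C) (h : ℝ) (hh : 0 ≤ h)
    (hVh : ∀ n, ‖V (n + 1) - B n (V n)‖ ≤ h + κ * ‖V n‖) (n : ℤ) : ‖V n‖ ≤ 2 * (K * h) := by
  refine le_two_mul_of_forall_bound_improves (fun n => ‖V n‖) (K * h) hV (fun S hS n => ?_) n
  have hS0 : 0 ≤ S := (norm_nonneg _).trans (hS 0)
  refine (hB V hV (h + κ * S) (by positivity) (fun n => (hVh n).trans ?_) n).trans ?_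
  · gcongr
    exact hS n
  · nlinarith

/-- Extension by zero to negative times turns `y` into a two-sided sequence whose only additional
residual is `y 0`, at step `-1`. -/
theorem HasAPrioriBound.norm_le_of_forward {A : E →L[ℝ] E} {K κ : ℝ}
    (hA : HasAPrioriBound (fun _ => A) K) (hκ : κ * (2 * K) ≤ 1) (hκ0 : 0 ≤ κ) (y : ℕ → E)
    (hy : ∃ C, ∀ j, ‖y j‖ ≤ C) (h : ∀ j, ‖y (j + 1) - A (y j)‖ ≤ κ * ‖y j‖) (j : ℕ) :
    ‖y j‖ ≤ 2 * K * ‖y 0‖ := by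
  obtain ⟨C, hC⟩ := hy
  have := hA.norm_le_of_perturbation hκ hκ0 (fun n => if 0 ≤ n then y n.toNat else 0)
    ⟨C, fun n => by
      split_ifs
      · exact hC _
      · simpa using (norm_nonneg _).trans (hC 0)⟩ ‖y 0‖ (norm_nonneg _) (fun n => by
        rcases lt_trichotomy n (-1) with hn | hn | hn
        · have h1 : ¬ (0 ≤ n + 1) := by omega
          have h2 : ¬ (0 ≤ n) := by omega
          simp [h1, h2]
        · subst hn
          simp
        · have h1 : 0 ≤ n := by omega
          lift n to ℕ using h1
          have h2 : ((n : ℤ) + 1).toNat = n + 1 := by omega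
          have h4 : (0 : ℤ) ≤ n + 1 := by omega
          simp only [h4, if_true, h2, Nat.cast_nonneg, Int.toNat_natCast]
          linarith [h n, norm_nonneg (y 0)]) j
  simpa [mul_assoc] using this

/-- Here the extension by zero is to positive times; the additional residual is `-A (y 0)`, whence
the factor `‖A‖`. -/
theorem HasAPrioriBound.norm_le_of_backward {A : E →L[ℝ] E} {K κ : ℝ}
    (hA : HasAPrioriBound (fun _ => A) K) (hκ : κ * (2 * K) ≤ 1) (hκ0 : 0 ≤ κ) (y : ℕ → E)
    (hy : ∃ C, ∀ j, ‖y j‖ ≤ C) (h : ∀ j, ‖y j - A (y (j + 1))‖ ≤ κ * ‖y (j + 1)‖) (j : ℕ) :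
    ‖y j‖ ≤ 2 * K * ‖A‖ * ‖y 0‖ := by
  obtain ⟨C, hC⟩ := hy
  have := hA.norm_le_of_perturbation hκ hκ0 (fun n => if n ≤ 0 then y (-n).toNat else 0)
    ⟨C, fun n => by
      split_ifs
      · exact hC _
      · simpa using (norm_nonneg _).trans (hC 0)⟩ (‖A‖ * ‖y 0‖) (by positivity) (fun n => by
        rcases lt_trichotomy n 0 with hn | hn | hn
        · obtain ⟨m, rfl⟩ : ∃ m : ℕ, n = -(m + 1 : ℕ) := ⟨(n + 1).natAbs, by omega⟩
          have h1 : -((m + 1 : ℕ) : ℤ) + 1 ≤ 0 := by omega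
          have h3 : (-(-((m + 1 : ℕ) : ℤ) + 1)).toNat = m := by omega
          have h4 : (-(-((m + 1 : ℕ) : ℤ))).toNat = m + 1 := by omega
          simp only [h1, hn.le, if_true, h3, h4]
          have : 0 ≤ ‖A‖ * ‖y 0‖ := by positivity
          linarith [h m]
        · subst hn
          have : 0 ≤ κ * ‖y 0‖ := by positivity
          simp only [zero_add, Int.reduceLE, if_false, le_refl, if_true, neg_zero, Int.toNat_zero,
            zero_sub, norm_neg]
          linarith [A.le_opNorm (y 0)]
        · have h1 : ¬ (n + 1 ≤ 0) := by omega
          have h2 : ¬ (n ≤ 0) := by omega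
          simp only [h1, h2, if_false, map_zero, sub_zero, norm_zero]
          positivity) (-j)
  simpa [mul_assoc] using this

end APriori

/-! ### From transversality to surjectivity of the variational operator. -/

section Tangent

variable {E : Type*} [NormedAddCommGroup E] [NormedSpace ℝ E]

/-- Initial values of the bounded forward solutions of `V(j+1) = B(j) V(j)`. -/
def forwardBounded (B : ℕ → E →L[ℝ] E) : Submodule ℝ E where
  carrier := {v | ∃ V : ℕ → E, (∃ C, ∀ j, ‖V j‖ ≤ C) ∧ V 0 = v ∧ ∀ j, V (j + 1) = B j (V j)}
  zero_mem' := ⟨fun _ => 0, ⟨0, by simp⟩, rfl, by simp⟩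
  add_mem' := by
    rintro v w ⟨V, ⟨C, hC⟩, hV0, hV⟩ ⟨W, ⟨D, hD⟩, hW0, hW⟩
    exact ⟨V + W, ⟨C + D, fun j => (norm_add_le _ _).trans (add_le_add (hC j) (hD j))⟩,
      by simp [hV0, hW0], fun j => by simp [hV, hW]⟩
  smul_mem' := by
    rintro c v ⟨V, ⟨C, hC⟩, hV0, hV⟩
    exact ⟨c • V, ⟨‖c‖ * C, fun j => (norm_smul_le _ _).trans
      (mul_le_mul_of_nonneg_left (hC j) (norm_nonneg c))⟩, by simp [hV0], fun j => by simp [hV]⟩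

/-- Initial values of the bounded backward solutions, `B(j) V(j+1) = V(j)`. -/
def backwardBounded (B : ℕ → E →L[ℝ] E) : Submodule ℝ E where
  carrier := {v | ∃ V : ℕ → E, (∃ C, ∀ j, ‖V j‖ ≤ C) ∧ V 0 = v ∧ ∀ j, B j (V (j + 1)) = V j}
  zero_mem' := ⟨fun _ => 0, ⟨0, by simp⟩, rfl, by simp⟩
  add_mem' := by
    rintro v w ⟨V, ⟨C, hC⟩, hV0, hV⟩ ⟨W, ⟨D, hD⟩, hW0, hW⟩
    exact ⟨V + W, ⟨C + D, fun j => (norm_add_le _ _).trans (add_le_add (hC j) (hD j))⟩,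
      by simp [hV0, hW0], fun j => by simp [hV, hW]⟩
  smul_mem' := by
    rintro c v ⟨V, ⟨C, hC⟩, hV0, hV⟩
    exact ⟨c • V, ⟨‖c‖ * C, fun j => (norm_smul_le _ _).trans
      (mul_le_mul_of_nonneg_left (hC j) (norm_nonneg c))⟩, by simp [hV0], fun j => by simp [hV]⟩

theorem norm_deriv_le_mul_of_eventually {f g : ℝ → E} {f' g' : E} {c : ℝ} (hf : HasDerivAt f f' 0)
    (hg : HasDerivAt g g' 0) (h : ∀ᶠ t in 𝓝 0, ‖f t - f 0‖ ≤ c * ‖g t - g 0‖) :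
    ‖f'‖ ≤ c * ‖g'‖ := by
  refine le_of_tendsto_of_tendsto (hasDerivAt_iff_tendsto_slope.1 hf).norm
    ((hasDerivAt_iff_tendsto_slope.1 hg).norm.const_mul c) ?_
  refine (h.filter_mono nhdsWithin_le_nhds).mono fun t ht => ?_
  simp only [slope, vsub_eq_sub, norm_smul]
  calc _ ≤ ‖(t - 0)⁻¹‖ * (c * ‖g t - g 0‖) := by gcongr
    _ = _ := by ring

theorem exists_bound_of_tail_bound {E : Type*} [NormedAddCommGroup E] (V : ℕ → E) (j₀ : ℕ)
    (C : ℝ) (h : ∀ j, ‖V (j₀ + j)‖ ≤ C) :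
    ∃ C, ∀ j, ‖V j‖ ≤ C := by
  have h0 : 0 ≤ C := (norm_nonneg _).trans (h 0)
  refine ⟨∑ i ∈ Finset.range j₀, ‖V i‖ + C, fun j => ?_⟩
  rcases lt_or_ge j j₀ with hj | hj
  · have := Finset.single_le_sum (f := fun i => ‖V i‖) (fun i _ => norm_nonneg _)
      (Finset.mem_range.2 hj)
    linarith
  · obtain ⟨i, rfl⟩ := Nat.exists_eq_add_of_le hj
    have : 0 ≤ ∑ i ∈ Finset.range j₀, ‖V i‖ := Finset.sum_nonneg fun i _ => norm_nonneg _
    linarith [h i]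

theorem exists_norm_sub_sub_le {F : E → E} (hF : ContDiff ℝ 1 F) {κ : ℝ} (hκ : 0 < κ) :
    ∃ ε > 0, ∀ x y, ‖x‖ < ε → ‖y‖ < ε → ‖F x - F y - fderiv ℝ F 0 (x - y)‖ ≤ κ * ‖x - y‖ := by
  have h := (hF.contDiffAt (x := 0)).hasStrictFDerivAt one_ne_zero
  have h1 := h.isLittleO.def hκ
  rw [nhds_prod_eq, Metric.nhds_basis_ball.prod_self.eventually_iff] at h1
  obtain ⟨ε, hε, h2⟩ := h1
  exact ⟨ε, hε, fun x y hx hy => h2 (x := (x, y)) ⟨by simpa using hx, by simpa using hy⟩⟩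

/-- The derivatives of `F^[j] (γ t)` at `t = 0` solve the variational equation. By uniform
convergence, from some `j₀` on and for all `t` at once, the orbits of `γ t` and `γ 0` stay where `F`
is nearly linear. Their difference is then bounded by its value at `j₀`, and the bound passes to
difference quotients. -/
theorem stableTangentSpace_le {F : E → E} (hF : ContDiff ℝ 1 F) {K : ℝ} (hK : 0 < K)
    (hA : HasAPrioriBound (fun _ => fderiv ℝ F 0) K) (p : E) :
    stableTangentSpace F p ≤ forwardBounded fun j => fderiv ℝ F (F^[j] p) := by
  refine Submodule.span_le.2 ?_
  rintro v ⟨γ, τ, hτ, hγ0, hγ, -, hunif⟩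
  obtain ⟨ε, hε, hloc⟩ := exists_norm_sub_sub_le hF (κ := 1 / (2 * K)) (by positivity)
  let V : ℕ → E := fun j => Nat.rec v (fun j w => fderiv ℝ F (F^[j] p) w) j
  have hV : ∀ j, HasDerivAt (fun t => F^[j] (γ t)) (V j) 0 := by
    intro j
    induction j with
    | zero => exact hγ
    | succ j ih =>
      have h1 : HasFDerivAt F (fderiv ℝ F (F^[j] p)) (F^[j] (γ 0)) := by
        rw [hγ0]
        exact (hF.differentiable one_ne_zero _).hasFDerivAt
      have h2 := h1.comp_hasDerivAt (0 : ℝ) ih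
      refine h2.congr_of_eventuallyEq (Eventually.of_forall fun t => ?_)
      exact Function.iterate_succ_apply' F j (γ t)
  obtain ⟨j₀, hj₀⟩ := eventually_atTop.1 (Metric.tendstoUniformlyOn_iff.1 hunif ε hε)
  have hsmall : ∀ j, ∀ t ∈ Set.Ioo (-τ) τ, ‖F^[j₀ + j] (γ t)‖ < ε := fun j t ht => by
    simpa using hj₀ (j₀ + j) (Nat.le_add_right _ _) t ht
  have h0 : (0 : ℝ) ∈ Set.Ioo (-τ) τ := ⟨by linarith, hτ⟩
  refine ⟨V, exists_bound_of_tail_bound V j₀ (2 * K * ‖V j₀‖) fun j => ?_, rfl, fun j => rfl⟩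
  refine norm_deriv_le_mul_of_eventually (hV _) (hV _) ?_
  filter_upwards [Ioo_mem_nhds h0.1 h0.2] with t ht
  refine hA.norm_le_of_forward (κ := 1 / (2 * K)) (by field_simp; rfl) (by positivity)
    (fun j => F^[j₀ + j] (γ t) - F^[j₀ + j] (γ 0)) ⟨ε + ε, fun j => (norm_sub_le _ _).trans
      (add_le_add (hsmall j t ht).le (hsmall j 0 h0).le)⟩ (fun j => ?_) j
  have := hloc _ _ (hsmall j t ht) (hsmall j 0 h0)
  rwa [← Function.iterate_succ_apply' F, ← Function.iterate_succ_apply' F] at this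

/-- The same argument backwards. The preimages are part of the data, so differentiating `F (Γ t
(j+1)) = Γ t j` replaces the use of an inverse. -/
theorem unstableTangentSpace_le {F : E → E} (hF : ContDiff ℝ 1 F) {K : ℝ} (hK : 0 < K)
    (hA : HasAPrioriBound (fun _ => fderiv ℝ F 0) K) (y : ℕ → E) :
    unstableTangentSpace F y ≤ backwardBounded fun j => fderiv ℝ F (y (j + 1)) := by
  refine Submodule.span_le.2 ?_
  rintro v ⟨Γ, τ, hτ, hΓ0, hv, hdiff, hΓ, hunif⟩
  obtain ⟨ε, hε, hloc⟩ := exists_norm_sub_sub_le hF (κ := 1 / (2 * K)) (by positivity)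
  have hV : ∀ j, HasDerivAt (fun t => Γ t j) (deriv (fun t => Γ t j) 0) 0 :=
    fun j => (hdiff j).hasDerivAt
  have h0 : (0 : ℝ) ∈ Set.Ioo (-τ) τ := ⟨by linarith, hτ⟩
  have hstep : ∀ j, fderiv ℝ F (y (j + 1)) (deriv (fun t => Γ t (j + 1)) 0)
      = deriv (fun t => Γ t j) 0 := fun j => by
    have h1 : HasFDerivAt F (fderiv ℝ F (y (j + 1))) (Γ 0 (j + 1)) := by
      rw [hΓ0]
      exact (hF.differentiable one_ne_zero _).hasFDerivAt
    have h2 := h1.comp_hasDerivAt (0 : ℝ) (hV (j + 1))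
    refine h2.unique ((hV j).congr_of_eventuallyEq ?_)
    filter_upwards [Ioo_mem_nhds h0.1 h0.2] with t ht
    exact (hΓ t ht).1 j
  obtain ⟨j₀, hj₀⟩ := eventually_atTop.1 (Metric.tendstoUniformlyOn_iff.1 hunif ε hε)
  have hsmall : ∀ j, ∀ t ∈ Set.Ioo (-τ) τ, ‖Γ t (j₀ + j)‖ < ε := fun j t ht => by
    simpa using hj₀ (j₀ + j) (Nat.le_add_right _ _) t ht
  refine ⟨fun j => deriv (fun t => Γ t j) 0, exists_bound_of_tail_bound _ j₀
    (2 * K * ‖fderiv ℝ F 0‖ * ‖deriv (fun t => Γ t j₀) 0‖) fun j => ?_, hv.deriv, hstep⟩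
  refine norm_deriv_le_mul_of_eventually (hV _) (hV _) ?_
  filter_upwards [Ioo_mem_nhds h0.1 h0.2] with t ht
  refine hA.norm_le_of_backward (κ := 1 / (2 * K)) (by field_simp; rfl) (by positivity)
    (fun j => Γ t (j₀ + j) - Γ 0 (j₀ + j)) ⟨ε + ε, fun j => (norm_sub_le _ _).trans
      (add_le_add (hsmall j t ht).le (hsmall j 0 h0).le)⟩ (fun j => ?_) j
  have := hloc _ _ (hsmall (j + 1) t ht) (hsmall (j + 1) 0 h0)
  rw [← add_assoc, (hΓ t ht).1, (hΓ 0 h0).1] at this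
  simpa only [add_assoc] using this

/-- If bounded forward and backward solutions span the space at every time, then the sequence
operator is surjective. -/
theorem surjective_seqOp_of_sup_eq_top [CompleteSpace E]
    (A : E →L[ℝ] E) (hA : Function.Bijective (seqOp (BoundedContinuousFunction.const ℤ A)))
    (B : ℤ →ᵇ (E →L[ℝ] E)) (hB : Tendsto B cofinite (𝓝 A))
    (h : ∀ n : ℤ, forwardBounded (fun j => B (n + j)) ⊔
      backwardBounded (fun j => B (n - (j + 1 : ℕ))) = ⊤) : Function.Surjective (seqOp B) := by
  have hdelta : ∀ (n : ℤ) (e : E), ∃ V, seqOp B V = deltaSeq n e := by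
    intro n e
    have he : e ∈ (⊤ : Submodule ℝ E) := Submodule.mem_top
    rw [← h (n + 1), Submodule.mem_sup] at he
    obtain ⟨_, ⟨V, ⟨C, hC⟩, rfl, hV⟩, _, ⟨W, ⟨D, hD⟩, rfl, hW⟩, hsum⟩ := he
    -- With `e = V 0 + W 0` split at time `n + 1`, following `V` from there on and `-W` before gives
    -- a bounded solution with jump exactly `e` at step `n`.
    refine ⟨bddSeq (fun i => if n + 1 ≤ i then V (i - (n + 1)).toNat else - W (n + 1 - i).toNat)
      ⟨max C D, fun i => ?_⟩, ?_⟩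
    · split_ifs
      · exact (hC _).trans (le_max_left _ _)
      · rw [norm_neg]
        exact (hD _).trans (le_max_right _ _)
    · ext1 i
      simp only [seqOp_apply, bddSeq_apply, deltaSeq_apply]
      rcases lt_trichotomy i n with hi | hi | hi
      · obtain ⟨m, rfl⟩ : ∃ m : ℕ, i = n + 1 - (m + 2 : ℕ) := ⟨(n - 1 - i).toNat, by omega⟩
        have h1 : ¬ (n + 1 ≤ n + 1 - ((m + 2 : ℕ) : ℤ) + 1) := by omega
        have h2 : ¬ (n + 1 ≤ n + 1 - ((m + 2 : ℕ) : ℤ)) := by omega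
        have h3 : (n + 1 - (n + 1 - ((m + 2 : ℕ) : ℤ) + 1)).toNat = m + 1 := by omega
        have h4 : (n + 1 - (n + 1 - ((m + 2 : ℕ) : ℤ))).toNat = m + 2 := by omega
        have h5 := hW (m + 1)
        rw [if_neg h1, if_neg h2, h3, h4, if_neg hi.ne, map_neg, h5]
        abel
      · subst hi
        have h5 := hW 0
        have h4 : i + 1 - ((0 + 1 : ℕ) : ℤ) = i := by simp
        simp only [h4] at h5
        rw [if_pos le_rfl, if_neg (by omega), if_pos rfl, ← hsum]
        simp [h5]
      · obtain ⟨m, rfl⟩ : ∃ m : ℕ, i = n + 1 + m := ⟨(i - (n + 1)).toNat, by omega⟩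
        have h3 : (n + 1 + (m : ℤ) + 1 - (n + 1)).toNat = m + 1 := by omega
        have h4 : (n + 1 + (m : ℤ) - (n + 1)).toNat = m := by omega
        rw [if_pos (by omega), if_pos (by omega), if_neg (by omega), h3, h4, hV m, sub_self]
  obtain ⟨B', s, hB', hs⟩ := exists_bijective_finite_modification A hA B hB
  -- Solve with the modified coefficients first; the error has finite support and is corrected by
  -- point sources.
  intro H
  obtain ⟨V, rfl⟩ := hB'.2 H
  have h1 := eq_sum_deltaSeq (seqOp B' V - seqOp B V) s fun n hn => by simp [hs n hn]
  choose W hW using hdelta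
  refine ⟨V + ∑ j ∈ s, W j ((seqOp B' V - seqOp B V) j), ?_⟩
  rw [map_add, map_sum, Finset.sum_congr rfl fun j _ => hW j _, ← h1, add_sub_cancel]

end Tangent

/-! ### Localization of a priori bounds. -/

section Windows

variable {E : Type*} [NormedAddCommGroup E] [NormedSpace ℝ E]

theorem HasAPrioriBound.conj {B B' : ℤ → E →L[ℝ] E} {K : ℝ} (hB : HasAPrioriBound B K)
    (T : E ≃ₗᵢ[ℝ] E) (c : ℤ) (h : ∀ n v, B' n (T v) = T (B (n - c) v)) : HasAPrioriBound B' K := by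
  rintro V ⟨C, hC⟩ d hd hV n
  have := hB (fun n => T.symm (V (n + c))) ⟨C, fun n => by simpa using hC _⟩ d hd (fun n => by
    have h1 := hV (n + c)
    rw [← T.symm.norm_map, map_sub] at h1
    have h2 : T.symm (B' (n + c) (V (n + c))) = B n (T.symm (V (n + c))) := by
      rw [LinearIsometryEquiv.symm_apply_eq]
      have := h (n + c) (T.symm (V (n + c)))
      rwa [T.apply_symm_apply, add_sub_cancel_right] at this
    rwa [h2, add_right_comm] at h1) (n - c)
  simpa using this

/-- An a priori bound holds if it holds, uniformly, for coefficients which are close in long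
windows around every time. -/
theorem hasAPrioriBound_of_windows {B : ℤ → E →L[ℝ] E} {b K ε : ℝ} {l : ℕ} (hl : 0 < l)
    (hε : 0 ≤ ε) (hb : ∀ n, ‖B n‖ ≤ b) (hsmall : K * (b / l + ε) ≤ 1 / 2)
    (hloc : ∀ n₀ : ℤ, ∃ B' : ℤ → E →L[ℝ] E, HasAPrioriBound B' K ∧
      ∀ n, |n - n₀| < l → ‖B n - B' n‖ ≤ ε) : HasAPrioriBound B (2 * K) := by
  intro V hV h hh hVh n
  rw [mul_assoc]
  refine le_two_mul_of_forall_bound_improves (fun n => ‖V n‖) (K * h) hV (fun S hS n₀ => ?_) n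
  obtain ⟨B', hB', hBB'⟩ := hloc n₀
  have hl' : (0 : ℝ) < l := Nat.cast_pos.2 hl
  have hS0 : 0 ≤ S := (norm_nonneg _).trans (hS 0)
  have hb0 : 0 ≤ b := (norm_nonneg _).trans (hb 0)
  -- A tent of height 1 at `n₀` and slope `1 / l`, vanishing outside the window. By the discrete
  -- product rule, `φ • V` has the residual of `V`, a commutator of size `b / l * S` and a
  -- coefficient error `ε * S`; `hsmall` lets these be absorbed.
  let φ : ℤ → ℝ := fun n => max (1 - ((|n - n₀| : ℤ) : ℝ) / l) 0
  have hφ0 : ∀ n, 0 ≤ φ n := fun n => le_max_right _ _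
  have hφ1 : ∀ n, φ n ≤ 1 := fun n => max_le (by
    have : (0 : ℝ) ≤ ((|n - n₀| : ℤ) : ℝ) / l := by positivity
    linarith) zero_le_one
  have hφ2 : ∀ n, |φ (n + 1) - φ n| ≤ 1 / l := fun n => by
    refine (abs_max_sub_max_le_abs _ _ _).trans ?_
    rw [sub_sub_sub_cancel_left, ← sub_div, abs_div, abs_of_pos hl']
    gcongr
    rw [← Int.cast_sub, ← Int.cast_abs]
    have : |(|n - n₀| - |n + 1 - n₀|)| ≤ 1 := by
      refine (abs_abs_sub_abs_le_abs_sub _ _).trans (le_of_eq ?_)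
      rw [show n - n₀ - (n + 1 - n₀) = -1 by ring]
      rfl
    exact_mod_cast this
  have hφ3 : ∀ n, ¬ |n - n₀| < l → φ n = 0 := fun n hn => by
    refine max_eq_right ?_
    rw [sub_nonpos, one_le_div hl']
    exact_mod_cast not_lt.1 hn
  have hφ4 : φ n₀ = 1 := by simp [φ]
  have key := hB' (fun n => φ n • V n) ⟨S, fun n => by
    rw [norm_smul, Real.norm_of_nonneg (hφ0 n)]
    exact (mul_le_of_le_one_left (norm_nonneg _) (hφ1 n)).trans (hS n)⟩
    (h + (b / l + ε) * S) (by positivity) (fun n => by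
      have h1 : φ (n + 1) • V (n + 1) - B' n (φ n • V n) = φ (n + 1) • (V (n + 1) - B n (V n))
          + (φ (n + 1) - φ n) • B n (V n) + φ n • (B n - B' n) (V n) := by
        simp only [map_smul, _root_.sub_apply]
        module
      rw [h1]
      have h2 : ‖φ (n + 1) • (V (n + 1) - B n (V n))‖ ≤ h := by
        rw [norm_smul, Real.norm_of_nonneg (hφ0 _)]
        exact (mul_le_of_le_one_left (norm_nonneg _) (hφ1 _)).trans (hVh n)
      have h3 : ‖(φ (n + 1) - φ n) • B n (V n)‖ ≤ 1 / l * (b * S) := by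
        rw [norm_smul]
        exact mul_le_mul (hφ2 n) (((B n).le_opNorm _).trans
          (mul_le_mul (hb n) (hS n) (norm_nonneg _) hb0)) (norm_nonneg _) (by positivity)
      have h4 : ‖φ n • (B n - B' n) (V n)‖ ≤ ε * S := by
        by_cases hn : |n - n₀| < l
        · rw [norm_smul, Real.norm_of_nonneg (hφ0 _)]
          exact (mul_le_of_le_one_left (norm_nonneg _) (hφ1 _)).trans
            (((B n - B' n).le_opNorm _).trans
              (mul_le_mul (hBB' n hn) (hS n) (norm_nonneg _) hε))
        · rw [hφ3 n hn, zero_smul, norm_zero]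
          positivity
      refine (norm_add₃_le).trans ?_
      calc _ ≤ h + 1 / l * (b * S) + ε * S := add_le_add (add_le_add h2 h3) h4
        _ = _ := by ring) n₀
  simp only [hφ4, one_smul] at key
  nlinarith

end Windows

/-! ### Existence and uniqueness of orbits near pseudo-orbits. -/

section Shadowing

variable {E : Type*} [NormedAddCommGroup E] [NormedSpace ℝ E]

/-- Orbits near a pseudo-orbit with an a priori bound are unique. -/
theorem orbit_unique_near {F : E → E} {W : ℤ → E} {B : ℤ → E →L[ℝ] E} {K Λ ρ : ℝ}
    (hB : HasAPrioriBound B K) (hΛ : 0 ≤ Λ) (hρ : 0 ≤ ρ) (hsmall : Λ * ρ * (2 * K) ≤ 1)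
    (hquad : ∀ n v w, ‖v‖ ≤ ρ → ‖w‖ ≤ ρ →
      ‖F (W n + v) - F (W n + w) - B n (v - w)‖ ≤ Λ * ρ * ‖v - w‖)
    {U V : ℤ → E} (hU : IsOrbit F U) (hV : IsOrbit F V) (hUW : ∀ n, ‖U n - W n‖ ≤ ρ)
    (hVW : ∀ n, ‖V n - W n‖ ≤ ρ) : V = U := by
  funext n
  have := hB.norm_le_of_perturbation hsmall (by positivity) (fun n => V n - U n)
    ⟨ρ + ρ, fun n => by
      rw [← sub_sub_sub_cancel_right _ _ (W n)]
      exact (norm_sub_le _ _).trans (add_le_add (hVW n) (hUW n))⟩ 0 le_rfl (fun n => by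
      have := hquad n _ _ (hVW n) (hUW n)
      rw [add_sub_cancel, add_sub_cancel, sub_sub_sub_cancel_right] at this
      simp only [hU n, hV n]
      linarith) n
  rw [mul_zero, mul_zero] at this
  exact sub_eq_zero.1 (norm_le_zero_iff.1 this)

/-- Near a pseudo-orbit with invertible linearization there is an orbit. -/
theorem exists_orbit_near [CompleteSpace E] {F : E → E} {W : ℤ → E} {B : ℤ →ᵇ (E →L[ℝ] E)}
    {K Λ e : ℝ} (hbij : Function.Bijective (seqOp B)) (hK : 0 < K) (hB : HasAPrioriBound B K)
    (hΛ : 0 ≤ Λ) (he : 0 ≤ e) (hsmall : Λ * (2 * (K * e)) * (2 * K) ≤ 1)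
    (hquad : ∀ n v w, ‖v‖ ≤ 2 * (K * e) → ‖w‖ ≤ 2 * (K * e) →
      ‖F (W n + v) - F (W n + w) - B n (v - w)‖ ≤ Λ * (2 * (K * e)) * ‖v - w‖)
    (herr : ∀ n, ‖W (n + 1) - F (W n)‖ ≤ e) :
    ∃ U, IsOrbit F U ∧ ∀ n, ‖U n - W n‖ ≤ 2 * (K * e) := by
  classical
  set R := 2 * (K * e) with hR
  have hR0 : 0 ≤ R := by positivity
  -- `W + V` is an orbit exactly when `V (n+1) - B n (V n) = f V n`, so `Φ`, the inverse operator
  -- applied to `f V`, has the corrections as fixed points. The default 0 in `N` is never met on the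
  -- ball `s`, where `f V` is bounded.
  let f : (ℤ →ᵇ E) → ℤ → E := fun V n => F (W n + V n) - B n (V n) - W (n + 1)
  let N : (ℤ →ᵇ E) → (ℤ →ᵇ E) := fun V => if h : ∃ C, ∀ n, ‖f V n‖ ≤ C then bddSeq (f V) h else 0
  let Φ : (ℤ →ᵇ E) → (ℤ →ᵇ E) := fun V => Function.surjInv hbij.2 (N V)
  let s : Set (ℤ →ᵇ E) := Metric.closedBall 0 R
  have hs : ∀ V ∈ s, ∀ n, ‖V n‖ ≤ R := fun V hV n =>
    (V.norm_coe_le_norm n).trans (mem_closedBall_zero_iff.1 hV)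
  have hf : ∀ V ∈ s, ∀ n, ‖f V n‖ ≤ Λ * R * R + e := fun V hV n => by
    have h1 := hquad n (V n) 0 (hs V hV n) (by simpa using hR0)
    have h2 := herr n
    rw [sub_zero, add_zero] at h1
    have h3 : f V n = (F (W n + V n) - F (W n) - B n (V n)) - (W (n + 1) - F (W n)) := by
      simp only [f]; abel
    rw [h3]
    refine (norm_sub_le _ _).trans (add_le_add (h1.trans ?_) h2)
    gcongr
    exact hs V hV n
  have hN : ∀ V ∈ s, ∀ n, N V n = f V n := fun V hV n => by
    simp only [N, dif_pos (⟨_, hf V hV⟩ : ∃ C, ∀ n, ‖f V n‖ ≤ C), bddSeq_apply]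
  have hΦ : ∀ V ∈ s, ∀ n, Φ V (n + 1) - B n (Φ V n) = f V n := fun V hV n => by
    rw [← hN V hV n, ← seqOp_apply]
    exact DFunLike.congr_fun (Function.surjInv_eq hbij.2 (N V)) n
  -- `K * e = R / 2` and `Λ * R * K ≤ 1 / 2`, so `K * (Λ * R * R + e) ≤ R`; the same smallness gives
  -- the contraction factor `1 / 2`.
  have hmaps : Set.MapsTo Φ s s := fun V hV => by
    refine mem_closedBall_zero_iff.2 ((BoundedContinuousFunction.norm_le hR0).2 fun n => ?_)
    refine (hB (Φ V) ⟨_, (Φ V).norm_coe_le_norm⟩ (Λ * R * R + e) (by positivity)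
      (fun n => by rw [hΦ V hV]; exact hf V hV n) n).trans ?_
    nlinarith
  have hcontr : ContractingWith (1 / 2) (hmaps.restrict Φ s s) := by
    refine ⟨by norm_num, LipschitzWith.of_dist_le_mul fun V V' => ?_⟩
    rw [Subtype.dist_eq, Subtype.dist_eq, dist_eq_norm, dist_eq_norm]
    have hd : (((1 / 2 : NNReal) : ℝ)) = 1 / 2 := by simp
    rw [hd]
    refine (BoundedContinuousFunction.norm_le (by positivity)).2 fun n => ?_
    refine (hB (fun n => Φ V n - Φ V' n) ⟨_, (Φ V - Φ V').norm_coe_le_norm⟩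
      (Λ * R * ‖(V : ℤ →ᵇ E) - V'‖) (by positivity) (fun n => ?_) n).trans ?_
    · have h1 : Φ V (n + 1) - Φ V' (n + 1) - B n (Φ V n - Φ V' n) = f V n - f V' n := by
        rw [← hΦ V V.2, ← hΦ V' V'.2, map_sub]; abel
      have h2 : f V n - f V' n = F (W n + (V : ℤ →ᵇ E) n) - F (W n + (V' : ℤ →ᵇ E) n)
          - B n ((V : ℤ →ᵇ E) n - (V' : ℤ →ᵇ E) n) := by
        simp only [f, map_sub]; abel
      rw [h1, h2]
      refine (hquad n _ _ (hs V V.2 n) (hs V' V'.2 n)).trans ?_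
      gcongr
      exact ((V : ℤ →ᵇ E) - V').norm_coe_le_norm n
    · nlinarith [norm_nonneg ((V : ℤ →ᵇ E) - V')]
  obtain ⟨V, hVs, hV, -⟩ := hcontr.exists_fixedPoint' Metric.isClosed_closedBall.isComplete hmaps
    (x := 0) (Metric.mem_closedBall_self hR0) (edist_ne_top _ _)
  refine ⟨fun n => W n + V n, fun n => ?_, fun n => ?_⟩
  · have h1 := hΦ V hVs n
    rw [hV.eq] at h1
    simp only [f] at h1
    have h2 : V (n + 1) = F (W n + V n) - W (n + 1) := by
      have := congrArg (· + B n (V n)) h1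
      simpa [sub_right_comm] using this
    simp [h2]
  · simpa using hs V hVs n

end Shadowing

/-! ### Second order estimates for the map. -/

section Taylor

variable {E : Type*} [NormedAddCommGroup E] [NormedSpace ℝ E]

theorem exists_lipschitz_fderiv [FiniteDimensional ℝ E] {F : E → E} (hF : ContDiff ℝ 2 F)
    (R : ℝ) : ∃ Λ > 0, ∀ x y, ‖x‖ ≤ R → ‖y‖ ≤ R →
      ‖fderiv ℝ F x - fderiv ℝ F y‖ ≤ Λ * ‖x - y‖ := by
  have : ProperSpace E := FiniteDimensional.proper ℝ E
  have h1 : ContDiff ℝ 1 (fderiv ℝ F) := hF.fderiv_right (by norm_num)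
  have h2 : Continuous (fderiv ℝ (fderiv ℝ F)) := h1.continuous_fderiv one_ne_zero
  obtain ⟨C, hC⟩ := (isCompact_closedBall (0 : E) R).exists_bound_of_continuousOn h2.continuousOn
  refine ⟨|C| + 1, by positivity, fun x y hx hy => ?_⟩
  exact (convex_closedBall (0 : E) R).norm_image_sub_le_of_norm_fderiv_le (𝕜 := ℝ)
    (fun z _ => h1.differentiable one_ne_zero z)
    (fun z hz => (hC z hz).trans ((le_abs_self C).trans (by linarith)))
    (mem_closedBall_zero_iff.2 hy) (mem_closedBall_zero_iff.2 hx)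

theorem norm_taylor_le {F : E → E} (hF : Differentiable ℝ F) {R Λ : ℝ} (hΛ : 0 ≤ Λ)
    (h : ∀ x y, ‖x‖ ≤ R → ‖y‖ ≤ R → ‖fderiv ℝ F x - fderiv ℝ F y‖ ≤ Λ * ‖x - y‖)
    {z v w : E} {ρ : ℝ} (hz : ‖z‖ + ρ ≤ R) (hv : ‖v‖ ≤ ρ) (hw : ‖w‖ ≤ ρ) :
    ‖F (z + v) - F (z + w) - fderiv ℝ F z (v - w)‖ ≤ Λ * ρ * ‖v - w‖ := by
  have hρ : 0 ≤ ρ := (norm_nonneg v).trans hv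
  have := (convex_closedBall z ρ).norm_image_sub_le_of_norm_fderiv_le' (𝕜 := ℝ) (f := F)
    (φ := fderiv ℝ F z) (C := Λ * ρ) (x := z + w) (y := z + v) (fun x _ => hF x) (fun x hx => by
      rw [Metric.mem_closedBall, dist_eq_norm] at hx
      refine (h x z ?_ (by linarith)).trans (by gcongr)
      have := norm_add_le (x - z) z
      rw [sub_add_cancel] at this
      linarith) (by simpa using hw) (by simpa using hv)
  rwa [add_sub_add_left_eq_sub] at this

theorem norm_map_sub_fderiv_le {F : E → E}
    (hF : Differentiable ℝ F) (hF0 : F 0 = 0) {R Λ : ℝ} (hΛ : 0 ≤ Λ)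
    (h : ∀ x y, ‖x‖ ≤ R → ‖y‖ ≤ R → ‖fderiv ℝ F x - fderiv ℝ F y‖ ≤ Λ * ‖x - y‖) {x : E}
    (hx : ‖x‖ ≤ R) : ‖F x - fderiv ℝ F 0 x‖ ≤ Λ * ‖x‖ ^ 2 := by
  have := norm_taylor_le hF hΛ h (z := 0) (v := x) (w := 0) (ρ := ‖x‖) (by simpa using hx)
    le_rfl (by simp)
  simpa [hF0, pow_two, mul_assoc] using this

/-- The mean value inequality for `t ↦ F (x + t) - F t`, whose derivative is at most `Λ * ‖x‖` and
whose value at 0 is `F x`. The product form matters because `x` may be a pulse near its centre,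
which is not small. -/
theorem norm_add_sub_sub_le {F : E → E} (hF : Differentiable ℝ F) (hF0 : F 0 = 0) {R Λ : ℝ}
    (h : ∀ x y, ‖x‖ ≤ R → ‖y‖ ≤ R → ‖fderiv ℝ F x - fderiv ℝ F y‖ ≤ Λ * ‖x - y‖)
    {x y : E} (hxy : ‖x‖ + ‖y‖ ≤ R) : ‖F (x + y) - F x - F y‖ ≤ Λ * ‖x‖ * ‖y‖ := by
  have h1 : ∀ t, HasFDerivAt (fun t => F (x + t) - F t) (fderiv ℝ F (x + t) - fderiv ℝ F t) t :=
    fun t => by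
      have h2 := HasFDerivAt.comp t (hF (x + t)).hasFDerivAt ((hasFDerivAt_id t).const_add x)
      rw [ContinuousLinearMap.comp_id] at h2
      exact h2.sub (hF t).hasFDerivAt
  have := (convex_closedBall (0 : E) ‖y‖).norm_image_sub_le_of_norm_hasFDerivWithin_le (𝕜 := ℝ)
    (f := fun t => F (x + t) - F t) (C := Λ * ‖x‖) (x := 0) (y := y)
    (fun t _ => (h1 t).hasFDerivWithinAt) (fun t ht => by
      have ht' : ‖t‖ ≤ ‖y‖ := by simpa using ht
      have := h (x + t) t ((norm_add_le _ _).trans (by linarith)) (by linarith [norm_nonneg x])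
      rwa [add_sub_cancel_right] at this) (by simp) (by simp)
  rw [add_zero, hF0, sub_zero, sub_zero] at this
  convert this using 2
  abel

end Taylor

/-! ### Interaction error of a sum of pulses. -/

section Superposition

/-- Since `j ≠ i`, every exponent is at least 1; one factor `x` is taken out and the rest is
dominated by powers of `1 / 2`. The constant does not see the size of `t`, which makes all later
estimates uniform in the number of pulses. -/
theorem exists_sum_pow_natAbs_le : ∃ c : ℝ, 0 < c ∧ ∀ (x : ℝ) (t : Finset ℕ) (i : ℕ), 0 ≤ x →
    x ≤ 1 / 2 → i ∉ t → ∑ j ∈ t, x ^ ((j : ℤ) - i).natAbs ≤ c * x := by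
  have hs : Summable fun j : ℤ => (2 : ℝ) ^ (-|j|) := summable_zpow_neg_abs one_lt_two
  refine ⟨2 * ∑' j : ℤ, (2 : ℝ) ^ (-|j|),
    mul_pos two_pos (hs.tsum_pos (fun j => by positivity) 0 (by simp)), fun x t i hx hx2 hi => ?_⟩
  have hinj : Function.Injective fun j : ℕ => (j : ℤ) - i := fun a b h => by simpa using h
  have h1 : ∀ j ∈ t, x ^ ((j : ℤ) - i).natAbs ≤ 2 * x * (2 : ℝ) ^ (-|(j : ℤ) - i|) := by
    intro j hj
    have hne : j ≠ i := fun h => hi (h ▸ hj)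
    obtain ⟨d, hd⟩ : ∃ d : ℕ, ((j : ℤ) - i).natAbs = d + 1 :=
      ⟨((j : ℤ) - i).natAbs - 1, by omega⟩
    have h2 : |(j : ℤ) - i| = ((d + 1 : ℕ) : ℤ) := by rw [← hd, Int.natCast_natAbs]
    rw [hd, h2, zpow_neg, zpow_natCast, pow_succ, pow_succ]
    have h3 : x ^ d ≤ (1 / 2) ^ d := pow_le_pow_left₀ hx hx2 d
    calc x ^ d * x ≤ (1 / 2) ^ d * x := by gcongr
      _ = _ := by
        rw [one_div, inv_pow]
        field_simp
  calc ∑ j ∈ t, x ^ ((j : ℤ) - i).natAbs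
      ≤ ∑ j ∈ t, 2 * x * (2 : ℝ) ^ (-|(j : ℤ) - i|) := Finset.sum_le_sum h1
    _ = 2 * x * ∑ j ∈ t, (2 : ℝ) ^ (-|(j : ℤ) - i|) := by rw [Finset.mul_sum]
    _ ≤ 2 * x * ∑' j : ℤ, (2 : ℝ) ^ (-|j|) := by
      gcongr
      refine ((hs.comp_injective hinj).sum_le_tsum t fun j _ => ?_).trans
        (tsum_comp_le_tsum_of_inj hs (fun j => by positivity) hinj)
      simp only [Function.comp]
      positivity
    _ = _ := by ring

variable {E : Type*} [NormedAddCommGroup E] [NormedSpace ℝ E]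

theorem norm_sum_sub_le_sum_erase {E : Type*} [NormedAddCommGroup E] {t : Finset ℕ} {i : ℕ}
    (hi : i ∈ t) (P : ℕ → E) :
    ‖∑ j ∈ t, P j - P i‖ ≤ ∑ j ∈ t.erase i, ‖P j‖ := by
  rw [← Finset.sum_erase_eq_sub hi]
  exact norm_sum_le _ _

/-- A superposition principle for a smooth map `F` with `F(0) = 0`. -/
theorem norm_sum_map_sub_map_sum_le {F : E → E} (hF : Differentiable ℝ F) (hF0 : F 0 = 0)
    {R Λ Y Z : ℝ} (hΛ : 0 ≤ Λ)
    (h : ∀ x y, ‖x‖ ≤ R → ‖y‖ ≤ R → ‖fderiv ℝ F x - fderiv ℝ F y‖ ≤ Λ * ‖x - y‖)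
    {t : Finset ℕ} {i : ℕ} (hi : i ∈ t) (P : ℕ → E) (hY : ∑ j ∈ t.erase i, ‖P j‖ ≤ Y)
    (hZ : ∑ j ∈ t.erase i, ‖P i‖ * ‖P j‖ ≤ Z) (hR : ‖P i‖ + Y ≤ R) :
    ‖∑ j ∈ t, F (P j) - F (∑ j ∈ t, P j)‖ ≤ Λ * (Z + 2 * Y ^ 2) := by
  have hlin : ∀ x, ‖x‖ ≤ R → ‖F x - fderiv ℝ F 0 x‖ ≤ Λ * ‖x‖ ^ 2 :=
    fun x hx => norm_map_sub_fderiv_le hF hF0 hΛ h hx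
  set y := ∑ j ∈ t.erase i, P j with hy
  have hyY : ‖y‖ ≤ Y := (norm_sum_le _ _).trans hY
  have hPi := norm_nonneg (P i)
  have hY0 : 0 ≤ Y := (norm_nonneg y).trans hyY
  have hPj : ∀ j ∈ t.erase i, ‖P j‖ ≤ Y := fun j hj =>
    (Finset.single_le_sum (f := fun j => ‖P j‖) (fun _ _ => norm_nonneg _) hj).trans hY
  have e1 : ∑ j ∈ t, P j = P i + y := (Finset.add_sum_erase t P hi).symm
  have e2 : ∑ j ∈ t, F (P j) = F (P i) + ∑ j ∈ t.erase i, F (P j) :=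
    (Finset.add_sum_erase t (fun j => F (P j)) hi).symm
  -- The linear parts at 0 of the terms other than `P i` cancel. What remains is two quadratic
  -- errors, each at most `Λ * Y ^ 2`, and the interaction of `P i` with the rest.
  have e3 : ∑ j ∈ t, F (P j) - F (∑ j ∈ t, P j)
      = (∑ j ∈ t.erase i, (F (P j) - fderiv ℝ F 0 (P j)) - (F y - fderiv ℝ F 0 y))
        - (F (P i + y) - F (P i) - F y) := by
    rw [e1, e2, Finset.sum_sub_distrib, ← map_sum, ← hy]
    abel
  have b1 : ‖∑ j ∈ t.erase i, (F (P j) - fderiv ℝ F 0 (P j))‖ ≤ Λ * Y ^ 2 := by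
    refine (norm_sum_le _ _).trans ?_
    calc _ ≤ ∑ j ∈ t.erase i, Λ * Y * ‖P j‖ := Finset.sum_le_sum fun j hj => by
            refine (hlin _ (by linarith [hPj j hj])).trans ?_
            rw [pow_two, ← mul_assoc]
            gcongr
            exact hPj j hj
      _ = Λ * Y * ∑ j ∈ t.erase i, ‖P j‖ := by rw [Finset.mul_sum]
      _ ≤ Λ * Y * Y := by gcongr
      _ = _ := by ring
  have b2 : ‖F y - fderiv ℝ F 0 y‖ ≤ Λ * Y ^ 2 := (hlin y (by linarith)).trans (by gcongr)
  have b3 : ‖F (P i + y) - F (P i) - F y‖ ≤ Λ * Z := by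
    refine (norm_add_sub_sub_le hF hF0 h (by linarith)).trans ?_
    rw [mul_assoc]
    gcongr
    refine le_trans ?_ hZ
    rw [← Finset.mul_sum]
    gcongr
    exact norm_sum_le _ _
  rw [e3]
  refine (norm_sub_le _ _).trans ((add_le_add ((norm_sub_le _ _).trans (add_le_add b1 b2))
    b3).trans (le_of_eq ?_))
  ring

end Superposition

/-! ### Distances between pulse centres. -/

section Centers

variable {m M : ℕ} {N : ℕ → ℕ}

theorem center_succ (N : ℕ → ℕ) {i : ℕ} (hi : 1 ≤ i) : center N (i + 1) = center N i + N i := by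
  rw [center, Finset.sum_Ico_succ_top hi]
  rfl

theorem mul_sub_le_center_sub (hM : ∀ i, 1 ≤ i → i ≤ m - 1 → M ≤ N i) {i j : ℕ} (hi : 1 ≤ i)
    (hij : i ≤ j) (hj : j ≤ m) : (M : ℤ) * ((j : ℤ) - i) ≤ center N j - center N i := by
  induction j, hij using Nat.le_induction with
  | base => simp
  | succ j hij ih =>
    have h1 := ih (by omega)
    have h2 : (M : ℤ) ≤ N j := by exact_mod_cast hM j (by omega) (by omega)
    rw [center_succ N (hi.trans hij)]
    push_cast
    linarith

theorem mul_natAbs_le_abs_center_sub (hM : ∀ i, 1 ≤ i → i ≤ m - 1 → M ≤ N i) {i j : ℕ}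
    (hi : i ∈ Finset.Icc 1 m) (hj : j ∈ Finset.Icc 1 m) :
    (M : ℤ) * ((j : ℤ) - i).natAbs ≤ |center N j - center N i| := by
  rw [Finset.mem_Icc] at hi hj
  rw [Int.natCast_natAbs]
  rcases le_total i j with h | h
  · rw [abs_of_nonneg (by omega)]
    exact (mul_sub_le_center_sub hM hi.1 h hj.2).trans (le_abs_self _)
  · rw [abs_sub_comm, abs_of_nonneg (by omega), abs_sub_comm]
    exact (mul_sub_le_center_sub hM hj.1 h hi.2).trans (le_abs_self _)

/-- Around every time there is a pulse from which it is no further than from the others. -/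
theorem exists_nearest_center (hm : 1 ≤ m) (hM : ∀ i, 1 ≤ i → i ≤ m - 1 → M ≤ N i) (n : ℤ) :
    ∃ i ∈ Finset.Icc 1 m, ∀ j ∈ Finset.Icc 1 m,
      (M : ℤ) * ((j : ℤ) - i).natAbs ≤ 2 * |n - center N j| ∧
      (M : ℤ) * ((j : ℤ) - i).natAbs ≤ |n - center N i| + |n - center N j| := by
  obtain ⟨i, hi, hmin⟩ := Finset.exists_min_image (Finset.Icc 1 m) (fun j => |n - center N j|)
    ⟨1, Finset.mem_Icc.2 ⟨le_rfl, hm⟩⟩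
  refine ⟨i, hi, fun j hj => ?_⟩
  have h1 := mul_natAbs_le_abs_center_sub hM hi hj
  have h2 := hmin j hj
  have h3 : |center N j - center N i| ≤ |n - center N i| + |n - center N j| := by
    have := abs_sub (n - center N i) (n - center N j)
    rwa [sub_sub_sub_cancel_left] at this
  constructor <;> linarith

/-- The domains end near the midpoints, so other centres are at least about half the distance of the
centres away. The `+ 1` is the loss when `N_i` is odd and the gluing point lies half a step off the
midpoint. -/
theorem mul_natAbs_le_of_mem_domain (hM : ∀ i, 1 ≤ i → i ≤ m - 1 → M ≤ N i) {i j : ℕ}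
    (hi : i ∈ Finset.Icc 1 m) (hj : j ∈ Finset.Icc 1 m) {n : ℤ}
    (hn : n ∈ leftDomain N i ∪ rightDomain m N i) :
    (M : ℤ) * ((j : ℤ) - i).natAbs ≤ 2 * |center N i + n - center N j| + 1 := by
  have h0 := mul_natAbs_le_abs_center_sub hM hi hj
  rw [Finset.mem_Icc] at hi hj
  have hmono : ∀ a b, 1 ≤ a → a ≤ b → b ≤ m → center N a ≤ center N b := fun a b ha hab hb => by
    have h1 := mul_sub_le_center_sub hM ha hab hb
    have h2 : 0 ≤ (M : ℤ) * ((b : ℤ) - a) := mul_nonneg (by positivity) (by omega)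
    omega
  rcases hn with ⟨hn0, hn⟩ | ⟨hn0, hn⟩
  · rcases lt_or_ge j i with h | h
    · have h1 := hn (by omega)
      have h2 := center_succ N (i := i - 1) (by omega)
      have h3 := hmono j (i - 1) hj.1 (by omega) (by omega)
      rw [Nat.sub_add_cancel hi.1] at h2
      rw [distMinus, distPlus] at h1
      rcases abs_cases (center N j - center N i) with h4 | h4 <;>
        rcases abs_cases (center N i + n - center N j) with h5 | h5 <;> omega
    · have h3 := hmono i j hi.1 h hj.2
      rcases abs_cases (center N j - center N i) with h4 | h4 <;>
        rcases abs_cases (center N i + n - center N j) with h5 | h5 <;> omega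
  · rcases lt_or_ge i j with h | h
    · have h1 := hn (by omega)
      have h2 := center_succ N hi.1
      have h3 := hmono (i + 1) j (by omega) h hj.2
      rw [distPlus] at h1
      rcases abs_cases (center N j - center N i) with h4 | h4 <;>
        rcases abs_cases (center N i + n - center N j) with h5 | h5 <;> omega
    · have h3 := hmono j i hj.1 h hi.2
      rcases abs_cases (center N j - center N i) with h4 | h4 <;>
        rcases abs_cases (center N i + n - center N j) with h5 | h5 <;> omega

/-- The domains of the remainder terms cover `ℤ`. -/
theorem exists_mem_domain (hm : 1 ≤ m) (N : ℕ → ℕ) (n : ℤ) :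
    ∃ i, 1 ≤ i ∧ i ≤ m ∧ n - center N i ∈ leftDomain N i ∪ rightDomain m N i := by
  -- The index sought is the last one whose left domain has begun by time `n`. Index 1 always
  -- qualifies; at the largest one the right domain cannot have ended, or the next index would
  -- qualify too.
  let s := (Finset.Icc 1 m).filter fun i => i ≠ 1 → center N i - distMinus N (i - 1) ≤ n
  have h1 : 1 ∈ s := by simp [s, hm]
  have hs := Finset.mem_filter.1 (s.max'_mem ⟨1, h1⟩)
  set i := s.max' ⟨1, h1⟩ with hi
  rw [Finset.mem_Icc] at hs
  refine ⟨i, hs.1.1, hs.1.2, ?_⟩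
  rcases le_or_gt n (center N i) with h | h
  · exact Or.inl ⟨by omega, fun h2 => by have := hs.2 h2; omega⟩
  · refine Or.inr ⟨by omega, fun h2 => ?_⟩
    by_contra hc
    have h3 : i + 1 ∈ s := by
      refine Finset.mem_filter.2 ⟨Finset.mem_Icc.2 ⟨by omega, by omega⟩, fun _ => ?_⟩
      rw [center_succ N hs.1.1, Nat.add_sub_cancel, distMinus]
      omega
    have := s.le_max' _ h3
    omega

/-- Between the centres `i` and `i + 1`, any further pulse is separated by the full distance to the
nearer of these two. The absent factor 2 is what improves `r^(-N)` to `r^(-2N)`. -/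
theorem mul_natAbs_le_of_eq_glue (hM : ∀ i, 1 ≤ i → i ≤ m - 1 → M ≤ N i) {i j : ℕ}
    (hi : 1 ≤ i) (him : i ≤ m - 1) (hj : j ∈ Finset.Icc 1 m) (hji : j ≠ i) (hji' : j ≠ i + 1) :
    (M : ℤ) * ((j : ℤ) - i).natAbs ≤ |center N i + distPlus N i - center N j| ∨
    (M : ℤ) * ((j : ℤ) - (i + 1 : ℕ)).natAbs ≤ |center N i + distPlus N i - center N j| := by
  have hj' := Finset.mem_Icc.1 hj
  have h1 : (0 : ℤ) ≤ distPlus N i := by rw [distPlus]; positivity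
  have h2 : distPlus N i ≤ N i := by rw [distPlus]; omega
  have hs := center_succ N hi
  rcases lt_or_ge j i with h | h
  · left
    have h3 := mul_sub_le_center_sub hM hj'.1 h.le (by omega)
    have e : (((j : ℤ) - i).natAbs : ℤ) = (i : ℤ) - j := by omega
    rw [e]
    refine h3.trans (le_trans ?_ (le_abs_self _))
    omega
  · right
    have h3 := mul_sub_le_center_sub hM (i := i + 1) (j := j) (by omega) (by omega) hj'.2
    have e : (((j : ℤ) - (i + 1 : ℕ)).natAbs : ℤ) = (j : ℤ) - (i + 1 : ℕ) := by omega
    rw [e]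
    refine h3.trans (le_trans ?_ (neg_le_abs _))
    omega

end Centers

/-! ### Estimates for the superposition of pulses. -/

section PulseSum

variable {k : ℕ} {G : Type*} [Group G]

/-- The pulse of `Q` with index `j`, moved to its centre and into its position. -/
noncomputable def pulse (T : G →* (EuclideanSpace ℝ (Fin k) ≃ₗᵢ[ℝ] EuclideanSpace ℝ (Fin k)))
    (Q : ℤ → EuclideanSpace ℝ (Fin k)) (N : ℕ → ℕ) (θ : ℕ → G) (n : ℤ) (j : ℕ) :
    EuclideanSpace ℝ (Fin k) :=
  T (θ j) (Q (n - center N j))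

/-- The superposition of the pulses `1, …, m`. -/
noncomputable def pulseSum (T : G →* (EuclideanSpace ℝ (Fin k) ≃ₗᵢ[ℝ] EuclideanSpace ℝ (Fin k)))
    (Q : ℤ → EuclideanSpace ℝ (Fin k)) (m : ℕ) (N : ℕ → ℕ) (θ : ℕ → G) (n : ℤ) :
    EuclideanSpace ℝ (Fin k) :=
  ∑ j ∈ Finset.Icc 1 m, pulse T Q N θ n j

/-- With `r = s ^ 2` and minimal distance `M = 2N`, the quantity `r^(-N)` is the integer power `s⁻¹
^ M`. The slack `a` accommodates odd distances and windows. -/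
theorem zpow_le_of_mul_le {s : ℝ} (hs : 1 < s) {M d a : ℕ} {e : ℤ}
    (h : (M : ℤ) * d ≤ 2 * e + a) : (s ^ 2) ^ (-e) ≤ s ^ a * (s⁻¹ ^ M) ^ d := by
  have hs0 : s ≠ 0 := (one_pos.trans hs).ne'
  have h1 : (s ^ 2) ^ (-e) = s ^ (-(2 * e)) := by
    rw [← zpow_natCast s 2, ← zpow_mul]
    congr 1
    push_cast
    ring
  have h2 : s ^ a * (s⁻¹ ^ M) ^ d = s ^ ((a : ℤ) - M * d) := by
    rw [← pow_mul, inv_pow, zpow_sub₀ hs0, div_eq_mul_inv]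
    norm_cast
  rw [h1, h2]
  exact zpow_le_zpow_right₀ hs.le (by linarith)

variable {T : G →* (EuclideanSpace ℝ (Fin k) ≃ₗᵢ[ℝ] EuclideanSpace ℝ (Fin k))}
  {Q : ℤ → EuclideanSpace ℝ (Fin k)} {m M : ℕ} {N : ℕ → ℕ} {θ : ℕ → G} {s D c : ℝ}

theorem norm_pulse_le (hs : 1 < s) (hD : 0 ≤ D) (hQ : ∀ n, ‖Q n‖ ≤ D * (s ^ 2) ^ (-|n|)) {n : ℤ}
    {j d a : ℕ} (h : (M : ℤ) * d ≤ 2 * |n - center N j| + a) :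
    ‖pulse T Q N θ n j‖ ≤ D * (s ^ a * (s⁻¹ ^ M) ^ d) := by
  rw [pulse, LinearIsometryEquiv.norm_map]
  exact (hQ _).trans (mul_le_mul_of_nonneg_left (zpow_le_of_mul_le hs h) hD)

theorem norm_pulse_le_const (hs : 1 < s) (hD : 0 ≤ D) (hQ : ∀ n, ‖Q n‖ ≤ D * (s ^ 2) ^ (-|n|))
    (n : ℤ) (j : ℕ) : ‖pulse T Q N θ n j‖ ≤ D := by
  have := norm_pulse_le (T := T) (θ := θ) (N := N) (M := 0) (d := 0) (a := 0) (n := n) (j := j)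
    hs hD hQ (by simp)
  simpa using this

theorem sum_erase_norm_pulse_le (hs : 1 < s) (hD : 0 ≤ D)
    (hQ : ∀ n, ‖Q n‖ ≤ D * (s ^ 2) ^ (-|n|))
    (hc : ∀ (x : ℝ) (t : Finset ℕ) (i : ℕ), 0 ≤ x → x ≤ 1 / 2 → i ∉ t →
      ∑ j ∈ t, x ^ ((j : ℤ) - i).natAbs ≤ c * x) (hx : s⁻¹ ^ M ≤ 1 / 2) {n : ℤ} {i a : ℕ}
    (h : ∀ j ∈ Finset.Icc 1 m, (M : ℤ) * ((j : ℤ) - i).natAbs ≤ 2 * |n - center N j| + a) :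
    ∑ j ∈ (Finset.Icc 1 m).erase i, ‖pulse T Q N θ n j‖ ≤ D * s ^ a * c * s⁻¹ ^ M := by
  have hs0 : 0 < s := one_pos.trans hs
  calc _ ≤ ∑ j ∈ (Finset.Icc 1 m).erase i, D * s ^ a * (s⁻¹ ^ M) ^ ((j : ℤ) - i).natAbs :=
        Finset.sum_le_sum fun j hj => by
          rw [mul_assoc]
          exact norm_pulse_le hs hD hQ (h j (Finset.mem_of_mem_erase hj))
    _ = D * s ^ a * ∑ j ∈ (Finset.Icc 1 m).erase i, (s⁻¹ ^ M) ^ ((j : ℤ) - i).natAbs := by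
        rw [Finset.mul_sum]
    _ ≤ D * s ^ a * (c * s⁻¹ ^ M) := by
        gcongr
        exact hc _ _ i (by positivity) hx (Finset.notMem_erase i _)
    _ = _ := by ring

theorem norm_pulseSum_le (hs : 1 < s) (hD : 0 ≤ D) (hc0 : 0 ≤ c)
    (hQ : ∀ n, ‖Q n‖ ≤ D * (s ^ 2) ^ (-|n|))
    (hc : ∀ (x : ℝ) (t : Finset ℕ) (i : ℕ), 0 ≤ x → x ≤ 1 / 2 → i ∉ t →
      ∑ j ∈ t, x ^ ((j : ℤ) - i).natAbs ≤ c * x) (hx : s⁻¹ ^ M ≤ 1 / 2) (hm : 1 ≤ m)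
    (hM : ∀ i, 1 ≤ i → i ≤ m - 1 → M ≤ N i) (n : ℤ) : ‖pulseSum T Q m N θ n‖ ≤ D + D * c := by
  obtain ⟨i, hi, hnear⟩ := exists_nearest_center hm hM n
  have h1 := sum_erase_norm_pulse_le (T := T) (θ := θ) (a := 0) hs hD hQ hc hx
    (fun j hj => by simpa using (hnear j hj).1)
  have h2 := norm_sum_sub_le_sum_erase hi (pulse T Q N θ n)
  have h3 := norm_pulse_le_const (T := T) (θ := θ) (N := N) hs hD hQ n i
  have h4 : D * s ^ 0 * c * s⁻¹ ^ M ≤ D * c := by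
    rw [pow_zero, mul_one]
    exact mul_le_of_le_one_right (by positivity) (by linarith)
  have h5 := norm_le_insert' (pulseSum T Q m N θ n) (pulse T Q N θ n i)
  rw [pulseSum] at h5 ⊢
  linarith

theorem norm_pulseSum_sub_le (hs : 1 < s) (hD : 0 ≤ D)
    (hQ : ∀ n, ‖Q n‖ ≤ D * (s ^ 2) ^ (-|n|))
    (hc : ∀ (x : ℝ) (t : Finset ℕ) (i : ℕ), 0 ≤ x → x ≤ 1 / 2 → i ∉ t →
      ∑ j ∈ t, x ^ ((j : ℤ) - i).natAbs ≤ c * x) (hx : s⁻¹ ^ M ≤ 1 / 2)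
    (hM : ∀ i, 1 ≤ i → i ≤ m - 1 → M ≤ N i) {i : ℕ} (hi : i ∈ Finset.Icc 1 m) {n : ℤ}
    (hn : n ∈ leftDomain N i ∪ rightDomain m N i) :
    ‖pulseSum T Q m N θ (center N i + n) - T (θ i) (Q n)‖ ≤ D * s * c * s⁻¹ ^ M := by
  have h1 := sum_erase_norm_pulse_le (T := T) (θ := θ) (a := 1) hs hD hQ hc hx
    (fun j hj => by exact_mod_cast mul_natAbs_le_of_mem_domain hM hi hj hn)
  have h2 := norm_sum_sub_le_sum_erase hi (pulse T Q N θ (center N i + n))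
  rw [pow_one] at h1
  have h3 : pulse T Q N θ (center N i + n) i = T (θ i) (Q n) := by
    rw [pulse, add_sub_cancel_left]
  rw [← h3]
  exact h2.trans h1

/-- At the gluing point the two adjacent pulses are removed, and each of the others is a full
distance away. Hence the geometric sums run in powers of `(s⁻¹ ^ M) ^ 2`. -/
theorem norm_pulseSum_sub_sub_le (hs : 1 < s) (hD : 0 ≤ D)
    (hQ : ∀ n, ‖Q n‖ ≤ D * (s ^ 2) ^ (-|n|))
    (hc : ∀ (x : ℝ) (t : Finset ℕ) (i : ℕ), 0 ≤ x → x ≤ 1 / 2 → i ∉ t →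
      ∑ j ∈ t, x ^ ((j : ℤ) - i).natAbs ≤ c * x) (hx : s⁻¹ ^ M ≤ 1 / 2)
    (hM : ∀ i, 1 ≤ i → i ≤ m - 1 → M ≤ N i) {i : ℕ} (hi : 1 ≤ i) (him : i ≤ m - 1) :
    ‖pulseSum T Q m N θ (center N i + distPlus N i) - T (θ i) (Q (distPlus N i))
      - T (θ (i + 1)) (Q (-distMinus N i))‖ ≤ 2 * D * c * (s⁻¹ ^ M) ^ 2 := by
  have hs0 : 0 < s := one_pos.trans hs
  set n := center N i + distPlus N i with hn
  have e1 : pulse T Q N θ n i = T (θ i) (Q (distPlus N i)) := by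
    rw [pulse, hn, add_sub_cancel_left]
  have e2 : pulse T Q N θ n (i + 1) = T (θ (i + 1)) (Q (-distMinus N i)) := by
    rw [pulse, hn, center_succ N hi, distMinus]
    congr 2
    ring
  have hmem : i ∈ Finset.Icc 1 m := Finset.mem_Icc.2 ⟨hi, by omega⟩
  have hmem' : i + 1 ∈ (Finset.Icc 1 m).erase i :=
    Finset.mem_erase.2 ⟨by omega, Finset.mem_Icc.2 ⟨by omega, by omega⟩⟩
  have e3 : pulseSum T Q m N θ n - pulse T Q N θ n i - pulse T Q N θ n (i + 1)
      = ∑ j ∈ ((Finset.Icc 1 m).erase i).erase (i + 1), pulse T Q N θ n j := by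
    rw [pulseSum, ← Finset.sum_erase_eq_sub hmem, ← Finset.sum_erase_eq_sub hmem']
  rw [← e1, ← e2, e3]
  set t := ((Finset.Icc 1 m).erase i).erase (i + 1) with ht
  have hx2 : (s⁻¹ ^ M) ^ 2 ≤ 1 / 2 := by nlinarith [show (0 : ℝ) ≤ s⁻¹ ^ M by positivity]
  have hb : ∀ j ∈ t, ‖pulse T Q N θ n j‖ ≤ D * ((s⁻¹ ^ M) ^ 2) ^ ((j : ℤ) - i).natAbs
      + D * ((s⁻¹ ^ M) ^ 2) ^ ((j : ℤ) - (i + 1 : ℕ)).natAbs := by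
    intro j hj
    simp only [ht, Finset.mem_erase] at hj
    rcases mul_natAbs_le_of_eq_glue hM hi him hj.2.2 hj.2.1 hj.1 with h | h
    · have := norm_pulse_le (T := T) (θ := θ) (N := N) (j := j) (n := n) (M := M) (a := 0)
        (d := 2 * ((j : ℤ) - i).natAbs) hs hD hQ
        (by rw [← hn] at h; push_cast at h ⊢; linarith)
      rw [pow_zero, one_mul, pow_mul] at this
      exact this.trans (le_add_of_nonneg_right (by positivity))
    · have := norm_pulse_le (T := T) (θ := θ) (N := N) (j := j) (n := n) (M := M) (a := 0)
        (d := 2 * ((j : ℤ) - (i + 1 : ℕ)).natAbs) hs hD hQ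
        (by rw [← hn] at h; push_cast at h ⊢; linarith)
      rw [pow_zero, one_mul, pow_mul] at this
      exact this.trans (le_add_of_nonneg_left (by positivity))
  refine (norm_sum_le _ _).trans ((Finset.sum_le_sum hb).trans ?_)
  rw [Finset.sum_add_distrib, ← Finset.mul_sum, ← Finset.mul_sum]
  have h1 := hc _ t i (by positivity) hx2 (by simp [ht])
  have h2 := hc _ t (i + 1) (by positivity) hx2 (by simp [ht])
  have h3 := mul_le_mul_of_nonneg_left h1 hD
  have h4 := mul_le_mul_of_nonneg_left h2 hD
  linarith

/-- Each pulse is an exact orbit by equivariance, so only the interaction error remains. -/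
theorem norm_pulseSum_step_le {F : EuclideanSpace ℝ (Fin k) → EuclideanSpace ℝ (Fin k)}
    (hF : Differentiable ℝ F) (hF0 : F 0 = 0) (hT : ∀ (g : G) U, F (T g U) = T g (F U))
    (hQF : IsOrbit F Q) {R Λ : ℝ} (hΛ : 0 ≤ Λ)
    (hlip : ∀ x y, ‖x‖ ≤ R → ‖y‖ ≤ R → ‖fderiv ℝ F x - fderiv ℝ F y‖ ≤ Λ * ‖x - y‖)
    (hs : 1 < s) (hD : 0 ≤ D) (hc0 : 0 ≤ c) (hR : D + D * c ≤ R)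
    (hQ : ∀ n, ‖Q n‖ ≤ D * (s ^ 2) ^ (-|n|))
    (hc : ∀ (x : ℝ) (t : Finset ℕ) (i : ℕ), 0 ≤ x → x ≤ 1 / 2 → i ∉ t →
      ∑ j ∈ t, x ^ ((j : ℤ) - i).natAbs ≤ c * x) (hx : s⁻¹ ^ M ≤ 1 / 2) (hm : 1 ≤ m)
    (hM : ∀ i, 1 ≤ i → i ≤ m - 1 → M ≤ N i) (n : ℤ) :
    ‖pulseSum T Q m N θ (n + 1) - F (pulseSum T Q m N θ n)‖
      ≤ Λ * (D ^ 2 * c + 2 * (D * c) ^ 2) * (s⁻¹ ^ M) ^ 2 := by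
  have hs0 : 0 < s := one_pos.trans hs
  obtain ⟨i, hi, hnear⟩ := exists_nearest_center hm hM n
  have hx2 : (s⁻¹ ^ M) ^ 2 ≤ 1 / 2 := by nlinarith [show (0 : ℝ) ≤ s⁻¹ ^ M by positivity]
  have hY := sum_erase_norm_pulse_le (T := T) (θ := θ) (a := 0) hs hD hQ hc hx
    (fun j hj => by simpa using (hnear j hj).1)
  rw [pow_zero, mul_one] at hY
  -- A single far pulse may be only of order `x = s⁻¹ ^ M`, but the distances of `n` to two centres
  -- add up to at least `M * |j - i|`, so each product is of order `x ^ 2`.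
  have hZ : ∑ j ∈ (Finset.Icc 1 m).erase i, ‖pulse T Q N θ n i‖ * ‖pulse T Q N θ n j‖
      ≤ D ^ 2 * c * (s⁻¹ ^ M) ^ 2 := by
    calc _ ≤ ∑ j ∈ (Finset.Icc 1 m).erase i,
          D ^ 2 * ((s⁻¹ ^ M) ^ 2) ^ ((j : ℤ) - i).natAbs := Finset.sum_le_sum fun j hj => by
            have h1 : ‖pulse T Q N θ n i‖ * ‖pulse T Q N θ n j‖
                ≤ (D * (s ^ 2) ^ (-|n - center N i|)) * (D * (s ^ 2) ^ (-|n - center N j|)) := by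
              rw [pulse, pulse, LinearIsometryEquiv.norm_map, LinearIsometryEquiv.norm_map]
              exact mul_le_mul (hQ _) (hQ _) (norm_nonneg _) (by positivity)
            have h2 := zpow_le_of_mul_le (M := M) (a := 0) (d := 2 * ((j : ℤ) - i).natAbs)
              (e := |n - center N i| + |n - center N j|) hs (by
                have := (hnear j (Finset.mem_of_mem_erase hj)).2
                push_cast
                push_cast at this
                linarith)
            rw [neg_add, zpow_add₀ (by positivity), pow_zero, one_mul, pow_mul] at h2
            calc _ ≤ _ := h1
              _ = D ^ 2 * ((s ^ 2) ^ (-|n - center N i|) * (s ^ 2) ^ (-|n - center N j|)) := by ring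
              _ ≤ _ := by gcongr
      _ = D ^ 2 * ∑ j ∈ (Finset.Icc 1 m).erase i, ((s⁻¹ ^ M) ^ 2) ^ ((j : ℤ) - i).natAbs := by
          rw [Finset.mul_sum]
      _ ≤ D ^ 2 * (c * (s⁻¹ ^ M) ^ 2) := by
          gcongr
          exact hc _ _ i (by positivity) hx2 (Finset.notMem_erase i _)
      _ = _ := by ring
  have h4 : D * c * s⁻¹ ^ M ≤ D * c := mul_le_of_le_one_right (by positivity) (by linarith)
  have h3 := norm_pulse_le_const (T := T) (θ := θ) (N := N) hs hD hQ n i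
  have key := norm_sum_map_sub_map_sum_le hF hF0 hΛ hlip hi (pulse T Q N θ n) hY hZ (by linarith)
  have e : pulseSum T Q m N θ (n + 1) = ∑ j ∈ Finset.Icc 1 m, F (pulse T Q N θ n j) := by
    rw [pulseSum]
    refine Finset.sum_congr rfl fun j _ => ?_
    rw [pulse, pulse, hT, ← hQF, add_sub_right_comm]
  rw [e, pulseSum]
  refine key.trans (le_of_eq ?_)
  ring

theorem IsHomoclinicOrbit.tendsto_cofinite {E : Type*} [NormedAddCommGroup E] [NormedSpace ℝ E]
    {F : E → E} {U : ℤ → E} (hU : IsHomoclinicOrbit F U) : Tendsto U cofinite (𝓝 0) := by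
  rw [Int.cofinite_eq]
  exact hU.2.2.sup hU.2.1

theorem tendsto_pulseSum (hQ : Tendsto Q cofinite (𝓝 0)) :
    Tendsto (pulseSum T Q m N θ) cofinite (𝓝 0) := by
  have : Tendsto (fun n => ∑ j ∈ Finset.Icc 1 m, pulse T Q N θ n j) cofinite
      (𝓝 (∑ j ∈ Finset.Icc 1 m, (0 : EuclideanSpace ℝ (Fin k)))) := by
    refine tendsto_finsetSum _ fun j _ => ?_
    have h1 := hQ.comp (sub_left_injective (b := center N j)).tendsto_cofinite
    have h2 := ((T (θ j)).continuous.tendsto 0).comp h1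
    rwa [map_zero] at h2
  rwa [Finset.sum_const_zero] at this

end PulseSum

/-! ### Invertibility of the variational equation along one and along many pulses. -/

section Linearization

theorem exists_bound_of_tendsto_cofinite {E : Type*} [NormedAddCommGroup E] {f : ℤ → E} {a : E}
    (hf : Tendsto f cofinite (𝓝 a)) : ∃ C, ∀ n, ‖f n‖ ≤ C := by
  have h1 : ∀ᶠ n in cofinite, ‖f n‖ < ‖a‖ + 1 := hf.norm.eventually_lt_const (by linarith)
  obtain ⟨c, -, hc⟩ := exists_le_mul_of_eventually_cofinite (fun n => ‖f n‖) (fun _ => 1)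
    (fun _ => one_pos) _ h1
  exact ⟨max (‖a‖ + 1) c, fun n => (hc n).elim (fun h => h.le.trans (le_max_left _ _))
    fun h => (by simpa using h : ‖f n‖ ≤ c).trans (le_max_right _ _)⟩

theorem IsOrbit.iterate {E : Type*} {F : E → E} [NormedAddCommGroup E] [NormedSpace ℝ E]
    {U : ℤ → E} (hU : IsOrbit F U) (n : ℤ) (j : ℕ) : F^[j] (U n) = U (n + j) := by
  induction j with
  | zero => simp
  | succ j ih => rw [Function.iterate_succ_apply', ih, ← hU, Nat.cast_succ, add_assoc]

/-- The variational equation along a transverse homoclinic orbit is invertible on bounded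
sequences. -/
theorem exists_hasAPrioriBound_of_transverse {E : Type*} [NormedAddCommGroup E] [NormedSpace ℝ E]
    [FiniteDimensional ℝ E] [CompleteSpace E] {F : E → E} (hF : ContDiff ℝ 1 F)
    (hA : Function.Bijective (seqOp (BoundedContinuousFunction.const ℤ (fderiv ℝ F 0))))
    {Q : ℤ → E} (hQ : IsHomoclinicOrbit F Q) (htrans : IntersectTransverselyAlong F Q) :
    ∃ K > 0, HasAPrioriBound (fun n => fderiv ℝ F (Q n)) K := by
  have hB : Tendsto (fun n => fderiv ℝ F (Q n)) cofinite (𝓝 (fderiv ℝ F 0)) :=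
    ((hF.continuous_fderiv one_ne_zero).tendsto 0).comp hQ.tendsto_cofinite
  let B := bddSeq (fun n => fderiv ℝ F (Q n)) (exists_bound_of_tendsto_cofinite hB)
  obtain ⟨K₀, hK₀, hA₀⟩ := exists_hasAPrioriBound _ hA
  have hsurj : Function.Surjective (seqOp B) := by
    refine surjective_seqOp_of_sup_eq_top _ hA B hB fun n => ?_
    rw [eq_top_iff, ← htrans n]
    refine sup_le_sup ?_ ?_
    · have := stableTangentSpace_le hF hK₀ hA₀ (Q n)
      simp only [hQ.1.iterate] at this
      exact this
    · exact unstableTangentSpace_le hF hK₀ hA₀ _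
  exact exists_hasAPrioriBound B
    ⟨(injective_iff_surjective_of_tendsto _ hA B hB).2 hsurj, hsurj⟩

theorem exists_window_length {s : ℝ} (hs : 1 < s) (K b a : ℝ) :
    ∃ l : ℕ, 0 < l ∧ K * (b / l + a * s⁻¹ ^ (2 * l)) ≤ 1 / 2 := by
  have h1 : Tendsto (fun l : ℕ => s⁻¹ ^ (2 * l)) atTop (𝓝 0) := by
    simp only [pow_mul]
    exact tendsto_pow_atTop_nhds_zero_of_lt_one (by positivity)
      (pow_lt_one₀ (by positivity) (inv_lt_one_of_one_lt₀ hs) two_ne_zero)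
  have h2 : Tendsto (fun l : ℕ => K * (b / l + a * s⁻¹ ^ (2 * l))) atTop (𝓝 (K * (0 + a * 0))) :=
    ((tendsto_const_div_atTop_nhds_zero_nat b).add (h1.const_mul a)).const_mul K
  rw [mul_zero, add_zero, mul_zero] at h2
  obtain ⟨l, hl⟩ := ((h2.eventually_le_const (show (0 : ℝ) < 1 / 2 by norm_num)).and
    (eventually_gt_atTop 0)).exists
  exact ⟨l, hl.2, hl.1⟩

variable {k : ℕ} {G : Type*} [Group G]
  {T : G →* (EuclideanSpace ℝ (Fin k) ≃ₗᵢ[ℝ] EuclideanSpace ℝ (Fin k))}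
  {Q : ℤ → EuclideanSpace ℝ (Fin k)} {m M : ℕ} {N : ℕ → ℕ} {θ : ℕ → G} {s D c : ℝ}

theorem fderiv_equivariant {F : EuclideanSpace ℝ (Fin k) → EuclideanSpace ℝ (Fin k)}
    (hF : Differentiable ℝ F) (hT : ∀ (g : G) U, F (T g U) = T g (F U)) (g : G)
    (x v : EuclideanSpace ℝ (Fin k)) :
    fderiv ℝ F (T g x) (T g v) = T g (fderiv ℝ F x v) := by
  let L : EuclideanSpace ℝ (Fin k) →L[ℝ] EuclideanSpace ℝ (Fin k) :=
    ((T g).toContinuousLinearEquiv : _ →L[ℝ] _)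
  have h1 : HasFDerivAt (F ∘ L) ((fderiv ℝ F (T g x)).comp L) x :=
    HasFDerivAt.comp x (hF (T g x)).hasFDerivAt L.hasFDerivAt
  have h2 : HasFDerivAt (L ∘ F) (L.comp (fderiv ℝ F x)) x :=
    HasFDerivAt.comp x L.hasFDerivAt (hF x).hasFDerivAt
  have h3 : F ∘ L = L ∘ F := funext fun y => hT g y
  rw [h3] at h1
  exact DFunLike.congr_fun (h1.unique h2) v

/-- The variational equation along a superposition of distant pulses inherits the a priori bound
of the variational equation along a single pulse. -/
theorem hasAPrioriBound_pulseSum {F : EuclideanSpace ℝ (Fin k) → EuclideanSpace ℝ (Fin k)}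
    (hF : Differentiable ℝ F) (hT : ∀ (g : G) U, F (T g U) = T g (F U)) {R Λ b K : ℝ} (hΛ : 0 ≤ Λ)
    (hlip : ∀ x y, ‖x‖ ≤ R → ‖y‖ ≤ R → ‖fderiv ℝ F x - fderiv ℝ F y‖ ≤ Λ * ‖x - y‖)
    (hb : ∀ x, ‖x‖ ≤ R → ‖fderiv ℝ F x‖ ≤ b)
    (hs : 1 < s) (hD : 0 ≤ D) (hc0 : 0 ≤ c) (hR : D + D * c ≤ R)
    (hQ : ∀ n, ‖Q n‖ ≤ D * (s ^ 2) ^ (-|n|))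
    (hc : ∀ (x : ℝ) (t : Finset ℕ) (i : ℕ), 0 ≤ x → x ≤ 1 / 2 → i ∉ t →
      ∑ j ∈ t, x ^ ((j : ℤ) - i).natAbs ≤ c * x) (hx : s⁻¹ ^ M ≤ 1 / 2) (hm : 1 ≤ m)
    (hM : ∀ i, 1 ≤ i → i ≤ m - 1 → M ≤ N i)
    (hK : HasAPrioriBound (fun n => fderiv ℝ F (Q n)) K) {l : ℕ} (hl : 0 < l) (hlM : 4 * l ≤ M)
    (hsmall : K * (b / l + Λ * (D * c) * s⁻¹ ^ (2 * l)) ≤ 1 / 2) :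
    HasAPrioriBound (fun n => fderiv ℝ F (pulseSum T Q m N θ n)) (2 * K) := by
  have hs0 : 0 < s := one_pos.trans hs
  have hW : ∀ n, ‖pulseSum T Q m N θ n‖ ≤ R := fun n =>
    (norm_pulseSum_le hs hD hc0 hQ hc hx hm hM n).trans hR
  refine hasAPrioriBound_of_windows hl (by positivity) (fun n => hb _ (hW n)) hsmall fun n₀ => ?_
  obtain ⟨i, hi, hnear⟩ := exists_nearest_center hm hM n₀
  refine ⟨fun n => fderiv ℝ F (pulse T Q N θ n i), hK.conj (T (θ i)) (center N i)
    (fun n v => fderiv_equivariant hF hT _ _ _), fun n hn => ?_⟩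
  -- Moving from `n₀` to `n` within the window costs at most `l` in each distance, hence the slack
  -- `2 * l`; `4 * l ≤ M` leaves a net gain of `s⁻¹ ^ (2 * l)`.
  have h1 := sum_erase_norm_pulse_le (T := T) (θ := θ) (N := N) (a := 2 * l) (n := n) (i := i)
    hs hD hQ hc hx
    (fun j hj => by
      have h2 := (hnear j hj).1
      have h3 : |n₀ - center N j| ≤ |n - n₀| + |n - center N j| := by
        have := abs_sub (n - center N j) (n - n₀)
        rw [sub_sub_sub_cancel_left] at this
        linarith
      rw [Nat.cast_mul 2 l, Nat.cast_ofNat]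
      linarith)
  have h2 := norm_sum_sub_le_sum_erase hi (pulse T Q N θ n)
  have h3 := norm_pulse_le_const (T := T) (θ := θ) (N := N) hs hD hQ n i
  have h4 : 0 ≤ D * c := by positivity
  refine (hlip _ _ (hW n) (by linarith)).trans ?_
  rw [mul_assoc]
  gcongr
  refine (h2.trans h1).trans ?_
  have h5 : s ^ (2 * l) * s⁻¹ ^ M ≤ s⁻¹ ^ (2 * l) := by
    calc s ^ (2 * l) * s⁻¹ ^ M ≤ s ^ (2 * l) * s⁻¹ ^ (2 * l + 2 * l) := by
          gcongr ?_ * ?_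
          exact pow_le_pow_of_le_one (by positivity) (inv_le_one_of_one_le₀ hs.le) (by omega)
      _ = s⁻¹ ^ (2 * l) := by
          rw [pow_add, ← mul_assoc, ← mul_pow, mul_inv_cancel₀ hs0.ne', one_pow, one_mul]
  calc D * s ^ (2 * l) * c * s⁻¹ ^ M = D * c * (s ^ (2 * l) * s⁻¹ ^ M) := by ring
    _ ≤ _ := by gcongr

end Linearization

end MultiPulse

/-! ### Choice of constants and the main theorem. -/

open MultiPulse in
theorem mainTheorem3 {k : ℕ}
    (F : EuclideanSpace ℝ (Fin k) → EuclideanSpace ℝ (Fin k))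
    (hF : ContDiff ℝ (⊤ : ℕ∞) F)
    {G : Type*} [Group G] [Finite G]
    (T : G →* (EuclideanSpace ℝ (Fin k) ≃ₗᵢ[ℝ] EuclideanSpace ℝ (Fin k)))
    (hT : ∀ (g : G) (U : EuclideanSpace ℝ (Fin k)), F (T g U) = T g (F U))
    (hF0 : F 0 = 0)
    (r : ℝ) (hr : MultiPulse.IsHyperbolic (fderiv ℝ F 0) r)
    (Q : ℤ → EuclideanSpace ℝ (Fin k)) (hQ : MultiPulse.IsHomoclinicOrbit F Q)
    (htrans : MultiPulse.IntersectTransverselyAlong F Q) :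
    ∃ N₀ : ℕ, 0 < N₀ ∧ ∃ δ : ℝ, 0 < δ ∧ ∃ C : ℝ, 0 < C ∧
      ∀ (m : ℕ) (N : ℕ → ℕ) (θ : ℕ → G), 1 < m →
        (∀ i : ℕ, 1 ≤ i → i ≤ m - 1 → N₀ ≤ N i) →
        ∃ U : ℤ → EuclideanSpace ℝ (Fin k),
          -- `U` is an `m`-pulse solution, and the only one
          (MultiPulse.IsHomoclinicOrbit F U ∧ MultiPulse.RemaindersLE T Q m N θ U δ) ∧
          (∀ V : ℤ → EuclideanSpace ℝ (Fin k), MultiPulse.IsOrbit F V →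
            MultiPulse.RemaindersLE T Q m N θ V δ → V = U) ∧
          -- the estimates of its remainder terms
          MultiPulse.RemaindersLE T Q m N θ U (C * r ^ (-MultiPulse.halfMinDist m N)) ∧
          ∀ i : ℕ, 1 ≤ i → i ≤ m - 1 →
            ‖MultiPulse.remainder T Q N θ U i (MultiPulse.distPlus N i)
                - T (θ (i + 1)) (Q (-MultiPulse.distMinus N i))‖
              ≤ C * r ^ (-2 * MultiPulse.halfMinDist m N) ∧
            ‖MultiPulse.remainder T Q N θ U (i + 1) (-MultiPulse.distMinus N i)
                - T (θ i) (Q (MultiPulse.distPlus N i))‖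
              ≤ C * r ^ (-2 * MultiPulse.halfMinDist m N) := by
  have hFd : Differentiable ℝ F := hF.differentiable (by simp)
  have hF1 : ContDiff ℝ 1 F := hF.of_le (by exact_mod_cast le_top)
  have hF2 : ContDiff ℝ 2 F := hF.of_le (WithTop.coe_le_coe.2 (le_top : (2 : ℕ∞) ≤ ⊤))
  obtain ⟨K₁, g, hg⟩ := hr.exists_isGreenFunction
  have hA := hg.bijective
  obtain ⟨KQ, hKQ, hBQ⟩ := exists_hasAPrioriBound_of_transverse hF1 hA hQ htrans
  -- exponential decay of the homoclinic orbit
  obtain ⟨D, hD, hQD⟩ : ∃ D > 0, ∀ n, ‖Q n‖ ≤ D * r ^ (-|n|) := by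
    obtain ⟨C, hC⟩ := exists_bound_of_tendsto_cofinite hQ.tendsto_cofinite
    obtain ⟨Λ, hΛ, hlip⟩ := exists_lipschitz_fderiv hF2 C
    obtain ⟨ε, hε, h⟩ := hg.exists_decay_of_sq_le Λ hΛ.le
    refine h Q ⟨C, hC⟩ (fun n => ?_) ?_
    · rw [hQ.1 n]
      exact norm_map_sub_fderiv_le hFd hF0 hΛ.le hlip (hC n)
    · have := hQ.tendsto_cofinite.norm.eventually_le_const (by rw [norm_zero]; exact hε)
      exact this
  obtain ⟨s, hs, rfl⟩ : ∃ s : ℝ, 1 < s ∧ s ^ 2 = r :=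
    ⟨√r, by rw [Real.lt_sqrt zero_le_one]; linarith [hg.one_lt],
      Real.sq_sqrt (by linarith [hg.one_lt])⟩
  have hs0 : 0 < s := one_pos.trans hs
  obtain ⟨c, hc0, hc⟩ := exists_sum_pow_natAbs_le
  set R := D + D * c with hR
  have hR0 : 0 ≤ R := by positivity
  -- `R` bounds every superposition of pulses, and the extra 1 leaves room for corrections of size
  -- `ρ ≤ 1`.
  obtain ⟨Λ, hΛ, hlip⟩ := exists_lipschitz_fderiv hF2 (R + 1)
  have hlip' : ∀ x y, ‖x‖ ≤ R → ‖y‖ ≤ R → ‖fderiv ℝ F x - fderiv ℝ F y‖ ≤ Λ * ‖x - y‖ :=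
    fun x y hx hy => hlip x y (by linarith) (by linarith)
  obtain ⟨b, hb⟩ := (isCompact_closedBall (0 : EuclideanSpace ℝ (Fin k))
    R).exists_bound_of_continuousOn (hF1.continuous_fderiv one_ne_zero).continuousOn
  have hb' : ∀ x, ‖x‖ ≤ R → ‖fderiv ℝ F x‖ ≤ b := fun x hx => hb x (mem_closedBall_zero_iff.2 hx)
  obtain ⟨l, hl, hlsmall⟩ := exists_window_length hs KQ b (Λ * (D * c))
  obtain ⟨ε, hε, hdecay⟩ := hg.exists_decay_of_sq_le Λ hΛ.le
  -- the constants
  set K := 2 * KQ with hK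
  have hK0 : 0 < K := by positivity
  set c₃ := Λ * (D ^ 2 * c + 2 * (D * c) ^ 2) with hc₃
  have hc₃0 : 0 < c₃ := by positivity
  set ρ := min 1 (1 / (2 * K * Λ)) with hρ
  have hρ0 : 0 < ρ := by positivity
  have hρ1 : ρ ≤ 1 := min_le_left _ _
  have hρ2 : Λ * ρ * (2 * K) ≤ 1 := by
    have := min_le_right 1 (1 / (2 * K * Λ))
    rw [← hρ, le_div_iff₀ (by positivity)] at this
    linarith
  -- The first term bounds `U - W`, the second the tails of the other pulses within the domain of
  -- one pulse.
  set C₁ := 2 * (K * c₃) + D * s * c with hC₁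
  have hC₁0 : 0 < C₁ := by positivity
  set x₀ := min (1 / 2) (min (ρ / 2) (ε / 2) / C₁) with hx₀
  have hx₀0 : 0 < x₀ := by positivity
  obtain ⟨N₁, hN₁⟩ := eventually_atTop.1 ((tendsto_pow_atTop_nhds_zero_of_lt_one
    (inv_nonneg.2 hs0.le) (inv_lt_one_of_one_lt₀ hs)).eventually_le_const hx₀0)
  -- `N₁` makes `x` small, and `4 * l` fits the windows between pulses. `δ = ρ / 2` leaves `ρ / 2`
  -- for the distance from `W` to the single pulse, so competitors lie in the uniqueness ball of
  -- radius `ρ` about `W`.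
  refine ⟨N₁ + 4 * l + 1, by omega, ρ / 2, by positivity, C₁ + 2 * D * c, by positivity,
    fun m N θ hm hN => ?_⟩
  obtain ⟨M, hMdef⟩ : ∃ M, M = sInf (N '' Set.Icc 1 (m - 1)) := ⟨_, rfl⟩
  have hM : ∀ i, 1 ≤ i → i ≤ m - 1 → M ≤ N i := fun i h1 h2 =>
    hMdef ▸ Nat.sInf_le ⟨i, ⟨h1, h2⟩, rfl⟩
  have hMN : N₁ + 4 * l + 1 ≤ M := by
    obtain ⟨i, hi, hi'⟩ := Nat.sInf_mem (s := N '' Set.Icc 1 (m - 1))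
      ⟨N 1, 1, ⟨le_rfl, by omega⟩, rfl⟩
    rw [hMdef, ← hi']
    exact hN i hi.1 hi.2
  have hpow : (s ^ 2) ^ (-halfMinDist m N) = s⁻¹ ^ M := by
    rw [halfMinDist, ← hMdef, ← Real.rpow_natCast s 2, ← Real.rpow_mul hs0.le, inv_pow,
      ← Real.rpow_natCast, ← Real.rpow_neg hs0.le]
    congr 1
    push_cast
    ring
  have hpow2 : (s ^ 2) ^ (-2 * halfMinDist m N) = (s⁻¹ ^ M) ^ 2 := by
    rw [← hpow, ← Real.rpow_natCast ((s ^ 2) ^ (-halfMinDist m N)) 2,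
      ← Real.rpow_mul (by positivity)]
    congr 1
    push_cast
    ring
  rw [hpow, hpow2]
  have hxM : s⁻¹ ^ M ≤ x₀ := hN₁ M (by omega)
  set x := s⁻¹ ^ M with hxdef
  have hx0 : 0 < x := by positivity
  have hx2 : x ≤ 1 / 2 := hxM.trans (min_le_left _ _)
  have hxC : C₁ * x ≤ min (ρ / 2) (ε / 2) := by
    have := hxM.trans (min_le_right _ _)
    rwa [le_div_iff₀ hC₁0, mul_comm] at this
  have hxρ : C₁ * x ≤ ρ / 2 := hxC.trans (min_le_left _ _)
  have hxε : C₁ * x ≤ ε / 2 := hxC.trans (min_le_right _ _)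
  have hxx : x ^ 2 ≤ x := by nlinarith
  have he1 : 2 * (K * (c₃ * x ^ 2)) ≤ 2 * (K * c₃) * x := by
    have : 2 * (K * c₃) * x ^ 2 ≤ 2 * (K * c₃) * x := by gcongr
    linarith
  have hsplit : C₁ * x = 2 * (K * c₃) * x + D * s * c * x := by rw [hC₁]; ring
  have hp1 : 0 ≤ 2 * (K * c₃) * x := by positivity
  have hp2 : 0 ≤ D * s * c * x := by positivity
  have he0 : 0 ≤ 2 * (K * (c₃ * x ^ 2)) := by positivity
  have heρ : 2 * (K * (c₃ * x ^ 2)) ≤ ρ := by linarith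
  -- the superposition of the pulses
  let W := pulseSum T Q m N θ
  have hWR : ∀ n, ‖W n‖ ≤ R := norm_pulseSum_le hs hD.le hc0.le hQD hc hx2 hm.le hM
  have hW0 : Tendsto W cofinite (𝓝 0) := tendsto_pulseSum hQ.tendsto_cofinite
  have hBW : HasAPrioriBound (fun n => fderiv ℝ F (W n)) K :=
    hasAPrioriBound_pulseSum hFd hT hΛ.le hlip' hb' hs hD.le hc0.le le_rfl hQD hc hx2 hm.le hM hBQ
      hl (by omega) hlsmall
  have hBt : Tendsto (fun n => fderiv ℝ F (W n)) cofinite (𝓝 (fderiv ℝ F 0)) :=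
    ((hF1.continuous_fderiv one_ne_zero).tendsto 0).comp hW0
  let B := bddSeq (fun n => fderiv ℝ F (W n)) (exists_bound_of_tendsto_cofinite hBt)
  have hinj : Function.Injective (seqOp B) := by
    refine (injective_iff_map_eq_zero _).2 fun V hV => ?_
    ext1 n
    have := hBW V ⟨_, V.norm_coe_le_norm⟩ 0 le_rfl (fun n => by
      have h1 : V (n + 1) - fderiv ℝ F (W n) (V n) = 0 := DFunLike.congr_fun hV n
      rw [h1, norm_zero]) n
    rw [mul_zero] at this
    exact norm_le_zero_iff.1 this
  -- The a priori bound gives only injectivity. Since `W` tends to 0 at both ends, the Fredholm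
  -- alternative supplies surjectivity.
  have hbij : Function.Bijective (seqOp B) :=
    ⟨hinj, (injective_iff_surjective_of_tendsto _ hA B hBt).1 hinj⟩
  have hquad : ∀ a, a ≤ ρ → ∀ n v w, ‖v‖ ≤ a → ‖w‖ ≤ a →
      ‖F (W n + v) - F (W n + w) - fderiv ℝ F (W n) (v - w)‖ ≤ Λ * a * ‖v - w‖ :=
    fun a ha n v w hv hw => norm_taylor_le hFd hΛ.le hlip (by linarith [hWR n]) hv hw
  obtain ⟨U, hU, hUW⟩ := exists_orbit_near (e := c₃ * x ^ 2) hbij hK0 hBW hΛ.le (by positivity)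
    (le_trans (by gcongr) hρ2) (hquad _ heρ)
    (norm_pulseSum_step_le hFd hF0 hT hQ.1 hΛ.le hlip' hs hD.le hc0.le le_rfl hQD hc hx2 hm.le hM)
  -- its properties
  have hUR : ∀ n, ‖U n‖ ≤ R + 1 := fun n => by
    have := norm_le_insert' (U n) (W n)
    linarith [hUW n, hWR n]
  -- Near both ends `W` is at most `ε / 2` and `U - W` is always at most `ε / 2`, so `U` enters the
  -- ball in which bounded orbits decay exponentially.
  obtain ⟨D', hD', hUD⟩ := hdecay U ⟨_, hUR⟩
    (fun n => by rw [hU n]; exact norm_map_sub_fderiv_le hFd hF0 hΛ.le hlip (hUR n)) (by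
      have := hW0.norm.eventually_le_const (show ‖(0 : EuclideanSpace ℝ (Fin k))‖ < ε / 2 by
        rw [norm_zero]; positivity)
      filter_upwards [this] with n hn
      have := norm_le_insert' (U n) (W n)
      linarith [hUW n])
  have hU0 : Tendsto U cofinite (𝓝 0) := by
    have h1 := ((summable_zpow_neg_abs hg.one_lt).mul_left D').tendsto_cofinite_zero
    exact squeeze_zero_norm hUD h1
  have hrem : RemaindersLE T Q m N θ U (C₁ * x) := fun i h1 h2 n hn => by
    have h3 := norm_pulseSum_sub_le (T := T) (θ := θ) hs hD.le hQD hc hx2 hM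
      (Finset.mem_Icc.2 ⟨h1, h2⟩) hn
    have h4 := norm_add_le (U (center N i + n) - W (center N i + n))
      (W (center N i + n) - T (θ i) (Q n))
    rw [sub_add_sub_cancel] at h4
    rw [remainder]
    linarith [hUW (center N i + n)]
  rw [Int.cofinite_eq] at hU0
  refine ⟨U, ⟨⟨hU, hU0.mono_left le_sup_right, hU0.mono_left le_sup_left⟩,
    fun i h1 h2 n hn => (hrem i h1 h2 n hn).trans hxρ⟩, fun V hV hVδ => ?_,
    fun i h1 h2 n hn => (hrem i h1 h2 n hn).trans ?_, fun i h1 h2 => ?_⟩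
  · refine orbit_unique_near hBW hΛ.le hρ0.le hρ2 (hquad ρ le_rfl) hU hV
      (fun n => (hUW n).trans heρ) fun n => ?_
    obtain ⟨i, h1, h2, hn⟩ := exists_mem_domain hm.le N n
    have h3 := norm_pulseSum_sub_le (T := T) (θ := θ) hs hD.le hQD hc hx2 hM
      (Finset.mem_Icc.2 ⟨h1, h2⟩) hn
    have h4 := hVδ i h1 h2 _ hn
    rw [remainder] at h4
    rw [add_sub_cancel] at h3 h4
    have h5 := norm_sub_le (V n - T (θ i) (Q (n - center N i))) (W n - T (θ i) (Q (n - center N i)))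
    rw [sub_sub_sub_cancel_right] at h5
    linarith
  · have : 0 ≤ 2 * D * c * x := by positivity
    linarith
  · have h3 := norm_pulseSum_sub_sub_le (T := T) (θ := θ) hs hD.le hQD hc hx2 hM h1 h2
    set n := center N i + distPlus N i with hn
    -- The right end of pulse `i` and the left end of pulse `i + 1` are the same time, so both
    -- estimates concern one vector, `U n` minus the two adjacent pulses.
    have hn' : center N (i + 1) + -distMinus N i = n := by
      rw [center_succ N h1, distMinus, hn]
      ring
    have h4 : ‖U n - T (θ i) (Q (distPlus N i)) - T (θ (i + 1)) (Q (-distMinus N i))‖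
        ≤ (C₁ + 2 * D * c) * x ^ 2 := by
      have h5 := norm_add_le (U n - W n)
        (W n - T (θ i) (Q (distPlus N i)) - T (θ (i + 1)) (Q (-distMinus N i)))
      have h6 : U n - W n + (W n - T (θ i) (Q (distPlus N i)) - T (θ (i + 1)) (Q (-distMinus N i)))
          = U n - T (θ i) (Q (distPlus N i)) - T (θ (i + 1)) (Q (-distMinus N i)) := by abel
      rw [h6] at h5
      have h7 : (C₁ + 2 * D * c) * x ^ 2 = 2 * (K * (c₃ * x ^ 2)) + D * s * c * x ^ 2
          + 2 * D * c * x ^ 2 := by rw [hC₁]; ring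
      have h8 : 0 ≤ D * s * c * x ^ 2 := by positivity
      linarith [hUW n]
    rw [remainder, remainder, hn', ← hn]
    exact ⟨h4, by rwa [sub_right_comm]⟩
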